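/- Let $A,B,R$ be finite-dimensional quantum systems, let $|\psi\rangle_{ABR}$ be a unit vector, $\rho_{AB}=\mathrm{Tr}_R|\psi\rangle\langle\psi|$ (so $R$ purifies $\rho_{AB}$), and let $\log$ be to base $2$. Write $F(\rho,\sigma)=\mathrm{Tr}\sqrt{\sqrt\sigma\,\rho\,\sqrt\sigma}$, $S$ for the von Neumann entropy and $|\Phi_K\rangle=K^{-1/2}\sum_{k=1}^K|k\rangle|k\rangle$. A real number $q$ is an achievable rate for state exchange if for every $\varepsilon>0$ and all sufficiently large $n$ there are integers $K,L\ge 1$ with $\log K-\log L\le n(q+\varepsilon)$ and a protocol of local operations and (free, two-way) classical communication between Alice (holding $A^n$ and one half of $\Phi_K$) and Bob (holding $B^n$ and the other half), not touching $R^n$, that transforms $\psi_{ABR}^{\otimes n}\otimes\Phi_K$ into a state of fidelity at least $1-\varepsilon$ with $\psi_{BAR}^{\otimes n}\otimes\Phi_L$, where $\psi_{BAR}$ is $\psi_{ABR}$ with the parts of Alice and Bob exchanged. The uncommon information $\Upsilon(A:B)$ is the infimum of the achievable rates. For $T\in\{A,B\}$ the one-way distillable entanglement $D^{\to}(R\rangle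 T)$ is the supremum of the reals $q$ such that for every $\varepsilon>0$ and all sufficiently large $n$ there are an integer $L\ge1$ with $\log L\ge n(q-\varepsilon)$, an instrument on $R^n$, and, for each of its outcomes (which is communicated from $R$ to $T$), a channel on $T^n$, which together transform $\rho_{RT}^{\otimes n}$ into a state of fidelity at least $1-\varepsilon$ with $\Phi_L$. Then $$\Upsilon(A:B)\ \ge\ D^{\to}(R\rangle A)+D^{\to}(R\rangle B),$$ and $$\Upsilon(A:B)\ \ge\ \sup_{\Lambda}\bigl[S(BV)-S(AV)\bigr],$$ that is, $\Upsilon(A:B)\ge S(BV)-S(AV)$ for every finite-dimensional system $V$ and every quantum channel $\Lambda:R\to V$, where $S(BV)$ and $S(AV)$ are the entropies of $(\mathrm{id}\otimes\Lambda)(\rho_{BR})$ and $(\mathrm{id}\otimes\Lambda)(\rho_{AR})$. -/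

import Mathlib

open scoped Kronecker ComplexOrder MatrixOrder

noncomputable section

namespace StateExchange

/-! Finite-dimensional quantum systems are finite index types `X`; vectors are functions `X → ℂ`,
operators are complex matrices, and tensor products are indexed by product types.
Logarithms are to base two. -/

/-- The rank-one operator `|φ⟩⟨φ|`. -/
def proj {X : Type} (φ : X → ℂ) : Matrix X X ℂ := Matrix.vecMulVec φ (star φ)

/-- `φ` is a unit vector. -/
def IsUnitVector {X : Type} [Fintype X] (φ : X → ℂ) : Prop := ∑ x, ‖φ x‖ ^ 2 = 1

/-- Von Neumann entropy `S(ρ) = -Tr ρ log₂ ρ`, through the continuous functional calculus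
of Hermitian matrices applied to `t ↦ -t log t`. -/
def entropy {X : Type} [Fintype X] [DecidableEq X] (ρ : Matrix X X ℂ) : ℝ :=
  (cfc Real.negMulLog ρ).trace.re / Real.log 2

/-- The fidelity `F(ρ,σ) = Tr √(√σ ρ √σ)`. -/
def fidelity {X : Type} [Fintype X] [DecidableEq X] (ρ σ : Matrix X X ℂ) : ℝ :=
  (CFC.sqrt (CFC.sqrt σ * ρ * CFC.sqrt σ)).trace.re

/-- A finite family of Kraus operators `X → Y` with `∑ₒ Mₒᴴ Mₒ = 1`.  With the outcome `o`
kept it is a (fine-grained) quantum instrument; with the outcome discarded it is a quantum channel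
(a completely positive trace-preserving map). -/
structure Kraus (X Y : Type) [Fintype Y] [DecidableEq X] where
  /-- number of Kraus operators -/
  num : ℕ
  /-- the Kraus operators -/
  op : Fin num → Matrix Y X ℂ
  complete : ∑ o, (op o).conjTranspose * op o = 1

/-- The channel with the given Kraus operators, applied to the second factor:
`(id ⊗ Λ)(ρ)`. -/
def Kraus.applySnd {Z X Y : Type} [Fintype Z] [DecidableEq Z] [Fintype X] [DecidableEq X]
    [Fintype Y] (Λ : Kraus X Y) (ρ : Matrix (Z × X) (Z × X) ℂ) : Matrix (Z × Y) (Z × Y) ℂ :=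
  ∑ o, ((1 : Matrix Z Z ℂ) ⊗ₖ Λ.op o) * ρ * ((1 : Matrix Z Z ℂ) ⊗ₖ Λ.op o).conjTranspose

/-- The maximally entangled vector `K^{-1/2} ∑ₖ |k⟩|k⟩`, i.e. `log₂ K` ebits. -/
def maxEnt (K : ℕ) (x : Fin K × Fin K) : ℂ := if x.1 = x.2 then ((Real.sqrt K)⁻¹ : ℝ) else 0

/-! ### Local operations and classical communication between Alice and Bob -/

/-- Finite-round LOCC from Alice : Bob systems `A : B` to `A' : B'`.  `IsLOCC A B T` says that `T`
lists the product Kraus operators `X ⊗ Y`, one for each complete classical transcript, of such a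
protocol.  In each round one party applies an instrument to her or his current system and announces
the outcome, and what follows (including who acts next) may depend on it. -/
inductive IsLOCC {A' B' : Type} [DecidableEq A'] [DecidableEq B'] :
    (A B : Type) → List (Matrix A' A ℂ × Matrix B' B ℂ) → Prop
  | done : IsLOCC A' B' [(1, 1)]
  | alice {A B C : Type} [DecidableEq A] [Fintype C] (M : Kraus A C)
      (T : Fin M.num → List (Matrix A' C ℂ × Matrix B' B ℂ))
      (hT : ∀ o, IsLOCC C B (T o)) :
      IsLOCC A B ((List.finRange M.num).flatMap fun o =>
        (T o).map fun p => (p.1 * M.op o, p.2))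
  | bob {A B C : Type} [DecidableEq B] [Fintype C] (M : Kraus B C)
      (T : Fin M.num → List (Matrix A' A ℂ × Matrix B' C ℂ))
      (hT : ∀ o, IsLOCC A C (T o)) :
      IsLOCC A B ((List.finRange M.num).flatMap fun o =>
        (T o).map fun p => (p.1, p.2 * M.op o))

/-- The output of the LOCC protocol with transcript operators `T`, on a state of `A ⊗ B ⊗ R`; the
reference `R` is untouched and the transcript is discarded. -/
def runLOCC {A B A' B' R : Type} [Fintype A] [Fintype B] [Fintype R] [DecidableEq R]
    (T : List (Matrix A' A ℂ × Matrix B' B ℂ)) (ρ : Matrix (A × B × R) (A × B × R) ℂ) :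
    Matrix (A' × B' × R) (A' × B' × R) ℂ :=
  (T.map fun p => (p.1 ⊗ₖ (p.2 ⊗ₖ (1 : Matrix R R ℂ))) * ρ *
    (p.1 ⊗ₖ (p.2 ⊗ₖ (1 : Matrix R R ℂ))).conjTranspose).sum

/-! ### State exchange and the uncommon information -/

section Exchange

variable {A B R : Type}

/-- `ψ^{⊗n}`, with the copies of each party's system grouped together. -/
def copies (ψ : A × B × R → ℂ) (n : ℕ) :
    (Fin n → A) × (Fin n → B) × (Fin n → R) → ℂ :=
  fun x => ∏ i, ψ (x.1 i, x.2.1 i, x.2.2 i)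

/-- The initial vector `ψ_{ABR}^{⊗n} ⊗ Φ_K`, where Alice holds `Aⁿ` and Bob holds `Bⁿ` and they
share the maximally entangled state `Φ_K`. -/
def exchangeInput (ψ : A × B × R → ℂ) (n K : ℕ) :
    ((Fin n → A) × Fin K) × ((Fin n → B) × Fin K) × (Fin n → R) → ℂ :=
  fun x => copies ψ n (x.1.1, x.2.1.1, x.2.2) * maxEnt K (x.1.2, x.2.1.2)

/-- The target vector `ψ_{BAR}^{⊗n} ⊗ Φ_L`: now Alice holds Bob's original system `Bⁿ`, Bob holds
Alice's original system `Aⁿ`, and `Φ_L` is what is left of the shared entanglement. -/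
def exchangeTarget (ψ : A × B × R → ℂ) (n L : ℕ) :
    ((Fin n → B) × Fin L) × ((Fin n → A) × Fin L) × (Fin n → R) → ℂ :=
  fun x => copies ψ n (x.2.1.1, x.1.1, x.2.2) * maxEnt L (x.1.2, x.2.1.2)

variable [Fintype A] [Fintype B] [Fintype R] [DecidableEq A] [DecidableEq B] [DecidableEq R]

/-- `q` is an achievable rate for state exchange: for large `n`, LOCC between Alice and Bob, with
net consumption of at most `n (q + ε)` ebits, maps `ψ_{ABR}^{⊗n}` to within fidelity `1 - ε` of
`ψ_{BAR}^{⊗n}`. -/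
def IsExchangeRate (ψ : A × B × R → ℂ) (q : ℝ) : Prop :=
  ∀ ε : ℝ, 0 < ε → ∃ N : ℕ, ∀ n : ℕ, N ≤ n → ∃ K L : ℕ, 0 < K ∧ 0 < L ∧
    Real.logb 2 K - Real.logb 2 L ≤ n * (q + ε) ∧
    ∃ T : List (Matrix ((Fin n → B) × Fin L) ((Fin n → A) × Fin K) ℂ ×
        Matrix ((Fin n → A) × Fin L) ((Fin n → B) × Fin K) ℂ),
      IsLOCC ((Fin n → A) × Fin K) ((Fin n → B) × Fin K) T ∧
      1 - ε ≤ fidelity (runLOCC T (proj (exchangeInput ψ n K))) (proj (exchangeTarget ψ n L))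

/-- The uncommon information `Υ(A:B)`: the least achievable rate for state exchange. -/
def uncommonInformation (ψ : A × B × R → ℂ) : EReal :=
  ⨅ q ∈ {q : ℝ | IsExchangeRate ψ q}, (q : EReal)

end Exchange

/-! ### One-way distillable entanglement -/

section Distillation

variable {X Y : Type}

/-- `ρ^{⊗n}` for a bipartite operator `ρ_{XY}`, with the copies of each system grouped. -/
def matrixCopies (ρ : Matrix (X × Y) (X × Y) ℂ) (n : ℕ) :
    Matrix ((Fin n → X) × (Fin n → Y)) ((Fin n → X) × (Fin n → Y)) ℂ :=
  fun x y => ∏ i, ρ (x.1 i, x.2 i) (y.1 i, y.2 i)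

/-- One-way LOCC from `X` to `Y`: the holder of `X` applies the instrument `M` and announces the
outcome `o`, and then the holder of `Y` applies the channel `N o`. -/
def runOneWay {X' Y' : Type} [Fintype X] [Fintype Y] [DecidableEq X] [DecidableEq Y]
    [Fintype X'] [Fintype Y'] (M : Kraus X X') (N : Fin M.num → Kraus Y Y')
    (ρ : Matrix (X × Y) (X × Y) ℂ) : Matrix (X' × Y') (X' × Y') ℂ :=
  ∑ o, ∑ j, (M.op o ⊗ₖ (N o).op j) * ρ * (M.op o ⊗ₖ (N o).op j).conjTranspose

variable [Fintype X] [Fintype Y] [DecidableEq X] [DecidableEq Y]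

/-- `q` is an achievable rate of one-way entanglement distillation, with communication from `X` to
`Y` only. -/
def IsOneWayDistillationRate (ρ : Matrix (X × Y) (X × Y) ℂ) (q : ℝ) : Prop :=
  ∀ ε : ℝ, 0 < ε → ∃ N : ℕ, ∀ n : ℕ, N ≤ n → ∃ L : ℕ, 0 < L ∧
    n * (q - ε) ≤ Real.logb 2 L ∧
    ∃ (M : Kraus (Fin n → X) (Fin L)) (D : Fin M.num → Kraus (Fin n → Y) (Fin L)),
      1 - ε ≤ fidelity (runOneWay M D (matrixCopies ρ n)) (proj (maxEnt L))

/-- The one-way distillable entanglement `D^→(X⟩Y)` of `ρ_{XY}`: the greatest achievable rate. -/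
def oneWayDistillable (ρ : Matrix (X × Y) (X × Y) ℂ) : EReal :=
  ⨆ q ∈ {q : ℝ | IsOneWayDistillationRate ρ q}, (q : EReal)

end Distillation

/-! ### Reduced states of `ψ_{ABR}` -/

section Reduced

variable {A B R : Type}

/-- `ρ_{RA} = Tr_B |ψ⟩⟨ψ|` -/
def stateRA [Fintype B] (ψ : A × B × R → ℂ) : Matrix (R × A) (R × A) ℂ :=
  fun x y => ∑ b, ψ (x.2, b, x.1) * star (ψ (y.2, b, y.1))

/-- `ρ_{RB} = Tr_A |ψ⟩⟨ψ|` -/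
def stateRB [Fintype A] (ψ : A × B × R → ℂ) : Matrix (R × B) (R × B) ℂ :=
  fun x y => ∑ a, ψ (a, x.2, x.1) * star (ψ (a, y.2, y.1))

/-- `ρ_{AR} = Tr_B |ψ⟩⟨ψ|` -/
def stateAR [Fintype B] (ψ : A × B × R → ℂ) : Matrix (A × R) (A × R) ℂ :=
  fun x y => ∑ b, ψ (x.1, b, x.2) * star (ψ (y.1, b, y.2))

/-- `ρ_{BR} = Tr_A |ψ⟩⟨ψ|` -/
def stateBR [Fintype A] (ψ : A × B × R → ℂ) : Matrix (B × R) (B × R) ℂ :=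
  fun x y => ∑ a, ψ (a, x.1, x.2) * star (ψ (a, y.1, y.2))

end Reduced

end StateExchange

end

open scoped Kronecker ComplexOrder MatrixOrder

noncomputable section

set_option linter.unusedSectionVars false

namespace StateExchange

/-! ### Square sums and Cauchy-Schwarz -/

/-! Of the LOCC structure only separability is used. By `IsLOCC.isIsometric` the transcript
operators satisfy `∑ᵢ Xᵢᴴ Xᵢ ⊗ Yᵢᴴ Yᵢ = 1`, and by `fidelity_runLOCC` the squared fidelity with the
pure target is `∑ᵢ |⟨target| Xᵢ ⊗ Yᵢ ⊗ 1 |input⟩|²`. An isometry on the reference changes none of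
these amplitudes (`amplitude_dilate`), so any processing of the reference may be imagined to have
taken place. Both bounds are one-shot estimates of this sum, combined with typical projections
(`exists_isTruncation_tensorPower`).

Entropy bound. Dilate `Λ` to an isometry `R → V ⊗ E`, count `V` with Alice and `E` with Bob. Across
this cut the entanglement is `n S(AV) + log K` before the exchange and `n S(BV) + log L` after it,
and separable operations cannot raise it. In quantitative form (`sum_sq_exchange_cut_le`), after
truncation the input has Schmidt rank at most `K r`, the marginal of the target is at most `β / L`,
and the success probability is at most `(K / L) r β` up to errors, with `r ≈ 2^{n S(AV)}` and `β ≈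
2^{-n S(BV)}`.

Distillation bound. If `R` and Alice can distill `Φ_ℓ`, the dilated state is close to a
superposition of terms in which `Φ_ℓ`, pulled back through the decoder, stands beside a leftover
state of Bob. Expanding input and target in this form and applying Cauchy–Schwarz bounds the success
probability by `(K / L) ℓ⁻² β² r r'` up to errors (`sum_sq_exchange_distill_le`), where `β ≈ 2^{-n
S(B)}`, `r ≈ 2^{n S(A)}`, `r' ≈ 2^{n S(B)}`. Hence `2 log ℓ₁ + n (S(B) - S(A)) ≲ log K - log L`.
Exchanging the roles of the parties gives `2 log ℓ₂ + n (S(A) - S(B)) ≲ log K - log L`; in the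
average of the two the entropies cancel, leaving `log ℓ₁ + log ℓ₂ ≲ log K - log L`. -/

/-- The squared Euclidean norm of a vector. -/
def normSq {ι : Type*} [Fintype ι] (v : ι → ℂ) : ℝ := ∑ i, ‖v i‖ ^ 2

lemma normSq_nonneg {ι : Type*} [Fintype ι] (v : ι → ℂ) : 0 ≤ normSq v :=
  Finset.sum_nonneg fun _ _ => sq_nonneg _

lemma ofReal_normSq {ι : Type*} [Fintype ι] (v : ι → ℂ) :
    ((normSq v : ℝ) : ℂ) = ∑ i, star (v i) * v i := by
  simp [normSq, Complex.conj_mul']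

lemma sq_norm_sum_mul_le {ι : Type*} [Fintype ι] (f g : ι → ℂ) :
    ‖∑ i, f i * g i‖ ^ 2 ≤ (∑ i, ‖f i‖ ^ 2) * ∑ i, ‖g i‖ ^ 2 := by
  refine le_trans ?_ (Finset.sum_mul_sq_le_sq_mul_sq Finset.univ (fun i => ‖f i‖) fun i => ‖g i‖)
  refine pow_le_pow_left₀ (norm_nonneg _) ?_ 2
  refine (norm_sum_le _ _).trans (le_of_eq ?_)
  simp

lemma sq_norm_add_le (x y : ℂ) : ‖x + y‖ ^ 2 ≤ 2 * ‖x‖ ^ 2 + 2 * ‖y‖ ^ 2 := by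
  have h := pow_le_pow_left₀ (norm_nonneg _) (norm_add_le x y) 2
  nlinarith [sq_nonneg (‖x‖ - ‖y‖)]

lemma sq_norm_add_add_le (x y z : ℂ) :
    ‖x + y + z‖ ^ 2 ≤ 3 * ‖x‖ ^ 2 + 3 * ‖y‖ ^ 2 + 3 * ‖z‖ ^ 2 := by
  have h := pow_le_pow_left₀ (norm_nonneg _) (norm_add₃_le (a := x) (b := y) (c := z)) 2
  nlinarith [sq_nonneg (‖x‖ - ‖y‖), sq_nonneg (‖x‖ - ‖z‖), sq_nonneg (‖y‖ - ‖z‖)]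

lemma normSq_add_le {ι : Type*} [Fintype ι] (u v : ι → ℂ) :
    normSq (u + v) ≤ 2 * normSq u + 2 * normSq v := by
  simp only [normSq, Finset.mul_sum, ← Finset.sum_add_distrib]
  exact Finset.sum_le_sum fun i _ => sq_norm_add_le _ _

/-! ### Isometric families -/

section Isometric

variable {E W R : Type*} [Fintype E] [Fintype W] [Fintype R] [DecidableEq R]

/-- The operators of the family are the blocks of an isometry `R → W ⊗ E`. -/
def IsIsometric (N : E → Matrix W R ℂ) : Prop := ∑ e, (N e).conjTranspose * N e = 1

lemma IsIsometric.inner_eq {N : E → Matrix W R ℂ} (h : IsIsometric N) (g k : R → ℂ) :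
    ∑ e, ∑ w, star (∑ r, N e w r * g r) * (∑ r, N e w r * k r) = ∑ r, star (g r) * k r := by
  have h1 : ∀ e, ∑ w, star (∑ r, N e w r * g r) * (∑ r, N e w r * k r)
      = star g ⬝ᵥ (((N e).conjTranspose * N e).mulVec k) := by
    intro e
    rw [← Matrix.mulVec_mulVec, Matrix.dotProduct_mulVec, ← Matrix.star_mulVec]
    rfl
  simp_rw [h1]
  rw [← dotProduct_sum, ← Matrix.sum_mulVec, show ∑ e, (N e).conjTranspose * N e = 1 from h,
    Matrix.one_mulVec]
  rfl

lemma IsIsometric.sum_sq {N : E → Matrix W R ℂ} (h : IsIsometric N) (g : R → ℂ) :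
    ∑ e, ∑ w, ‖∑ r, N e w r * g r‖ ^ 2 = ∑ r, ‖g r‖ ^ 2 := by
  have h1 := h.inner_eq g g
  simp only [Complex.star_def, Complex.conj_mul'] at h1
  exact_mod_cast h1

/-- With `V` the isometry built from the blocks, `‖Vᴴ z‖² = ⟨V Vᴴ z, z⟩ ≤ ‖V Vᴴ z‖ ‖z‖ = ‖Vᴴ z‖
‖z‖`, by Cauchy–Schwarz and `IsIsometric.sum_sq`. -/
lemma IsIsometric.sum_sq_adjoint_le {N : E → Matrix W R ℂ} (h : IsIsometric N) (z : E → W → ℂ) :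
    ∑ r, ‖∑ e, ∑ w, star (N e w r) * z e w‖ ^ 2 ≤ ∑ e, ∑ w, ‖z e w‖ ^ 2 := by
  set g : R → ℂ := fun r => ∑ e, ∑ w, star (N e w r) * z e w with hg
  have h1 : ((∑ r, ‖g r‖ ^ 2 : ℝ) : ℂ)
      = ∑ x : E × W, star (∑ r, N x.1 x.2 r * g r) * z x.1 x.2 := by
    rw [Fintype.sum_prod_type]
    push_cast
    simp_rw [← Complex.conj_mul']
    have h2 : ∀ r, (starRingEnd ℂ) (g r) * g r
        = ∑ e, ∑ w, (starRingEnd ℂ) (g r) * (star (N e w r) * z e w) := by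
      intro r
      conv_lhs => rw [hg]
      simp only [Finset.mul_sum]
      rfl
    simp_rw [h2]
    rw [Finset.sum_comm]
    refine Finset.sum_congr rfl fun e _ => ?_
    rw [Finset.sum_comm]
    refine Finset.sum_congr rfl fun w _ => ?_
    rw [star_sum, Finset.sum_mul]
    refine Finset.sum_congr rfl fun r _ => ?_
    simp only [star_mul', Complex.star_def]
    ring
  have h3 := sq_norm_sum_mul_le (fun x : E × W => star (∑ r, N x.1 x.2 r * g r))
    (fun x => z x.1 x.2)
  rw [← h1] at h3
  simp only [norm_star, Fintype.sum_prod_type, h.sum_sq] at h3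
  have h0 : 0 ≤ ∑ r, ‖g r‖ ^ 2 := Finset.sum_nonneg fun _ _ => sq_nonneg _
  rw [Complex.norm_real, Real.norm_of_nonneg h0, sq] at h3
  by_contra hlt
  push Not at hlt
  have hpos : 0 < ∑ r, ‖g r‖ ^ 2 :=
    lt_of_le_of_lt (Finset.sum_nonneg fun _ _ => Finset.sum_nonneg fun _ _ => sq_nonneg _) hlt
  exact absurd (le_of_mul_le_mul_left h3 hpos) (not_le.2 hlt)

end Isometric

lemma Kraus.isIsometric {X Y : Type} [Fintype X] [Fintype Y] [DecidableEq X] (M : Kraus X Y) :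
    IsIsometric M.op := M.complete

/-! ### Fidelity with a pure state -/

lemma IsUnitVector.dotProduct {X : Type} [Fintype X] {φ : X → ℂ} (h : IsUnitVector φ) :
    star φ ⬝ᵥ φ = 1 := by
  have := ofReal_normSq φ
  rw [show normSq φ = 1 from h] at this
  rw [Complex.ofReal_one] at this
  exact this.symm

lemma proj_mul_proj {X : Type} [Fintype X] {φ : X → ℂ} (h : IsUnitVector φ) :
    proj φ * proj φ = proj φ := by
  rw [proj, Matrix.vecMulVec_mul_vecMulVec, h.dotProduct, one_smul]

lemma proj_nonneg {X : Type} [Fintype X] (φ : X → ℂ) : 0 ≤ proj φ :=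
  Matrix.nonneg_iff_posSemidef.2 (Matrix.posSemidef_vecMulVec_self_star φ)

/-- A rank-one projection is its own square root, and compressing `ρ` by it gives `c` times the
projection, so the outer square root is explicit. -/
lemma fidelity_proj {X : Type} [Fintype X] [DecidableEq X] {φ : X → ℂ} (h : IsUnitVector φ)
    (ρ : Matrix X X ℂ) (c : ℝ) (hc : 0 ≤ c) (hρ : star φ ⬝ᵥ ρ.mulVec φ = c) :
    fidelity ρ (proj φ) = Real.sqrt c := by
  have h1 : CFC.sqrt (proj φ) = proj φ := CFC.sqrt_unique (proj_mul_proj h) (proj_nonneg φ)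
  have h2 : proj φ * ρ * proj φ = (c : ℂ) • proj φ := by
    rw [Matrix.mul_assoc]
    rw [proj, Matrix.mul_vecMulVec, Matrix.vecMulVec_mul_vecMulVec, hρ, Matrix.vecMulVec_smul]
  have h3 : CFC.sqrt ((c : ℂ) • proj φ) = ((Real.sqrt c : ℝ) : ℂ) • proj φ := by
    refine CFC.sqrt_unique ?_ ?_
    · rw [smul_mul_smul_comm, proj_mul_proj h, ← Complex.ofReal_mul, Real.mul_self_sqrt hc]
    · refine smul_nonneg ?_ (proj_nonneg φ)
      exact_mod_cast Real.sqrt_nonneg c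
  rw [fidelity, h1, h2, h3, Matrix.trace_smul, proj, Matrix.trace_vecMulVec, dotProduct_comm,
    h.dotProduct]
  simp

lemma dotProduct_kraus_proj {X Y : Type*} [Fintype X] [Fintype Y] (Z : Matrix Y X ℂ)
    (τ : Y → ℂ) (φ : X → ℂ) :
    star τ ⬝ᵥ (Z * Matrix.vecMulVec φ (star φ) * Z.conjTranspose).mulVec τ
      = ((‖star τ ⬝ᵥ Z.mulVec φ‖ ^ 2 : ℝ) : ℂ) := by
  rw [Matrix.mul_vecMulVec, Matrix.vecMulVec_mul, ← Matrix.star_mulVec, Matrix.vecMulVec_mulVec,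
    dotProduct_smul, Complex.ofReal_pow, ← Complex.mul_conj']
  congr 1
  rw [starRingEnd_apply, ← Matrix.star_dotProduct_star, star_star, dotProduct_comm]
  rfl

/-! ### LOCC protocols are isometric families -/

lemma gram_mul_apply {X Y Z : Type*} [Fintype Y] [Fintype Z] (P : Matrix Z Y ℂ) (M : Matrix Y X ℂ)
    (x x' : X) : ((P * M).conjTranspose * (P * M)) x x'
      = ∑ c, ∑ c', star (M c x) * M c' x' * (P.conjTranspose * P) c c' := by
  rw [Matrix.conjTranspose_mul, Matrix.mul_assoc, ← Matrix.mul_assoc P.conjTranspose,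
    Matrix.mul_apply]
  refine Finset.sum_congr rfl fun c _ => ?_
  rw [Matrix.mul_apply, Finset.mul_sum]
  refine Finset.sum_congr rfl fun c' _ => ?_
  rw [Matrix.conjTranspose_apply]
  ring

lemma Kraus.sum_star_mul {X Y : Type} [Fintype Y] [DecidableEq X] (M : Kraus X Y) (x x' : X) :
    ∑ o, ∑ c, star (M.op o c x) * M.op o c x' = if x = x' then 1 else 0 := by
  have h := congrFun (congrFun M.complete x) x'
  rw [Matrix.sum_apply, Matrix.one_apply] at h
  exact h

-- The systems change along the induction and need not carry `Fintype` or `DecidableEq` instances,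
-- hence the entrywise form and classical equality. In a round, completeness of the continuation
-- after each outcome collapses the inner sum, and completeness of the round's own instrument does
-- the rest.
open Classical in
lemma IsLOCC.complete {A' B' : Type} [Fintype A'] [Fintype B'] [DecidableEq A'] [DecidableEq B']
    {A B : Type} {T : List (Matrix A' A ℂ × Matrix B' B ℂ)} (h : IsLOCC A B T) :
    ∀ (a a' : A) (b b' : B),
      (T.map fun p => (p.1.conjTranspose * p.1) a a' * (p.2.conjTranspose * p.2) b b').sum
        = (if a = a' then 1 else 0) * (if b = b' then 1 else 0) := by
  induction h with
  | done =>
    intro a a' b b'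
    simp only [List.map_cons, List.map_nil, List.sum_cons, List.sum_nil, add_zero,
      Matrix.conjTranspose_one, Matrix.one_mul, Matrix.one_apply]
    congr
  | @alice A B C _ _ M T hT ih =>
    intro a a' b b'
    have key : ∀ o, (((T o).map fun p => (p.1 * M.op o, p.2)).map
        (fun p : Matrix A' A ℂ × Matrix B' B ℂ =>
        (p.1.conjTranspose * p.1) a a' * (p.2.conjTranspose * p.2) b b')).sum
        = (∑ c, star (M.op o c a) * M.op o c a') * (if b = b' then 1 else 0) := by
      intro o
      have h2 : ∑ c, ∑ c', star (M.op o c a) * M.op o c' a' *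
            ((if c = c' then 1 else 0) * (if b = b' then 1 else 0))
          = (∑ c, star (M.op o c a) * M.op o c a') * (if b = b' then (1 : ℂ) else 0) := by
        rw [Finset.sum_mul]
        refine Finset.sum_congr rfl fun c _ => ?_
        simp
      rw [← h2]
      simp_rw [← ih o, ← List.sum_map_mul_left]
      rw [List.map_map]
      simp only [← Fin.sum_univ_fun_getElem]
      simp only [Function.comp_apply, gram_mul_apply, Finset.sum_mul]
      rw [Finset.sum_comm]
      refine Finset.sum_congr rfl fun c _ => ?_
      rw [Finset.sum_comm]
      simp only [mul_assoc]
    have h4 := Finset.sum_congr (s₁ := Finset.univ) rfl fun o _ => key o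
    rw [← Finset.sum_mul, M.sum_star_mul] at h4
    rw [List.map_flatMap, List.flatMap_def, List.sum_flatten, List.map_map, ← Fin.sum_univ_def]
    refine h4.trans ?_
    congr
  | @bob A B C _ _ M T hT ih =>
    intro a a' b b'
    have key : ∀ o, (((T o).map fun p => (p.1, p.2 * M.op o)).map
        (fun p : Matrix A' A ℂ × Matrix B' B ℂ =>
        (p.1.conjTranspose * p.1) a a' * (p.2.conjTranspose * p.2) b b')).sum
        = (if a = a' then 1 else 0) * ∑ c, star (M.op o c b) * M.op o c b' := by
      intro o
      have h2 : ∑ c, ∑ c', star (M.op o c b) * M.op o c' b' *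
            ((if a = a' then 1 else 0) * (if c = c' then 1 else 0))
          = (if a = a' then (1 : ℂ) else 0) * ∑ c, star (M.op o c b) * M.op o c b' := by
        rw [Finset.mul_sum]
        refine Finset.sum_congr rfl fun c _ => ?_
        simp
      rw [← h2]
      simp_rw [← ih o, ← List.sum_map_mul_left]
      rw [List.map_map]
      simp only [← Fin.sum_univ_fun_getElem]
      simp only [Function.comp_apply, gram_mul_apply, Finset.mul_sum]
      rw [Finset.sum_comm]
      refine Finset.sum_congr rfl fun c _ => ?_
      rw [Finset.sum_comm]
      refine Finset.sum_congr rfl fun c' _ => Finset.sum_congr rfl fun i _ => ?_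
      ring
    have h4 := Finset.sum_congr (s₁ := Finset.univ) rfl fun o _ => key o
    rw [← Finset.mul_sum, M.sum_star_mul] at h4
    rw [List.map_flatMap, List.flatMap_def, List.sum_flatten, List.map_map, ← Fin.sum_univ_def]
    refine h4.trans ?_
    congr

lemma IsLOCC.isIsometric {A' B' : Type} [Fintype A'] [Fintype B'] [DecidableEq A'] [DecidableEq B']
    {A B : Type} [Fintype A] [Fintype B] [DecidableEq A] [DecidableEq B]
    {T : List (Matrix A' A ℂ × Matrix B' B ℂ)} (h : IsLOCC A B T) :
    IsIsometric fun i : Fin T.length => T[i].1 ⊗ₖ T[i].2 := by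
  unfold IsIsometric
  ext ⟨a, b⟩ ⟨a', b'⟩
  have h1 := h.complete a a' b b'
  rw [← Fin.sum_univ_fun_getElem] at h1
  simp_rw [Matrix.conjTranspose_kronecker, ← Matrix.mul_kronecker_mul]
  rw [Matrix.sum_apply]
  simp only [Matrix.kroneckerMap_apply]
  refine h1.trans ?_
  by_cases ha : a = a' <;> by_cases hb : b = b' <;> simp [Matrix.one_apply, ha, hb]

/-! ### Transition amplitudes of product operators -/

section Amplitude

variable {A₁ A₂ A₃ B₁ B₂ B₃ S ι : Type*} [Fintype A₁] [Fintype A₂] [Fintype A₃] [Fintype B₁]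
  [Fintype B₂] [Fintype B₃] [Fintype S] [Fintype ι]

/-- The vector `(X ⊗ Y ⊗ 1) v`. -/
def localAct (X : Matrix A₂ A₁ ℂ) (Y : Matrix B₂ B₁ ℂ) (v : A₁ × B₁ × S → ℂ) :
    A₂ × B₂ × S → ℂ :=
  fun x => ∑ y : A₁ × B₁, (X ⊗ₖ Y) (x.1, x.2.1) y * v (y.1, y.2, x.2.2)

/-- The matrix element `⟨u| X ⊗ Y ⊗ 1 |v⟩`. -/
def amplitude (X : Matrix A₂ A₁ ℂ) (Y : Matrix B₂ B₁ ℂ) (u : A₂ × B₂ × S → ℂ)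
    (v : A₁ × B₁ × S → ℂ) : ℂ :=
  ∑ x, star (u x) * localAct X Y v x

lemma localAct_sub (X : Matrix A₂ A₁ ℂ) (Y : Matrix B₂ B₁ ℂ) (v v' : A₁ × B₁ × S → ℂ) :
    localAct X Y (v - v') = localAct X Y v - localAct X Y v' := by
  funext x
  simp [localAct, mul_sub, Finset.sum_sub_distrib]

lemma amplitude_sub_right (X : Matrix A₂ A₁ ℂ) (Y : Matrix B₂ B₁ ℂ) (u : A₂ × B₂ × S → ℂ)
    (v v' : A₁ × B₁ × S → ℂ) :
    amplitude X Y u (v - v') = amplitude X Y u v - amplitude X Y u v' := by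
  simp [amplitude, localAct_sub, mul_sub, Finset.sum_sub_distrib]

lemma amplitude_sub_left (X : Matrix A₂ A₁ ℂ) (Y : Matrix B₂ B₁ ℂ) (u u' : A₂ × B₂ × S → ℂ)
    (v : A₁ × B₁ × S → ℂ) :
    amplitude X Y (u - u') v = amplitude X Y u v - amplitude X Y u' v := by
  simp [amplitude, sub_mul, Finset.sum_sub_distrib]

/-- Replacing both vectors of an amplitude. -/
lemma sq_norm_amplitude_le (X : Matrix A₂ A₁ ℂ) (Y : Matrix B₂ B₁ ℂ) (u u' : A₂ × B₂ × S → ℂ)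
    (v v' : A₁ × B₁ × S → ℂ) :
    ‖amplitude X Y u v‖ ^ 2 ≤ 3 * ‖amplitude X Y u' v'‖ ^ 2
      + 3 * ‖amplitude X Y u' (v - v')‖ ^ 2 + 3 * ‖amplitude X Y (u - u') v‖ ^ 2 := by
  refine le_trans (le_of_eq ?_) (sq_norm_add_add_le _ _ _)
  rw [amplitude_sub_right, amplitude_sub_left]
  congr 2
  ring

lemma normSq_prod_assoc (v : A₁ × B₁ × S → ℂ) :
    normSq v = ∑ s, ∑ y : A₁ × B₁, ‖v (y.1, y.2, s)‖ ^ 2 := by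
  simp only [normSq, Fintype.sum_prod_type]
  rw [Finset.sum_comm' (t' := Finset.univ) (s' := fun _ => Finset.univ) (by simp)]
  have : ∀ a, ∑ b, ∑ s, ‖v (a, b, s)‖ ^ 2 = ∑ s, ∑ b, ‖v (a, b, s)‖ ^ 2 :=
    fun a => Finset.sum_comm
  rw [Finset.sum_comm]
  simp_rw [this]
  exact Finset.sum_comm

lemma sum_mul_sum_prod (f : A₁ → ℂ) (g : B₁ → ℂ) :
    (∑ a, f a) * ∑ b, g b = ∑ y : A₁ × B₁, f y.1 * g y.2 := by
  rw [Finset.sum_mul_sum, Fintype.sum_prod_type]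

lemma normSq_mul {S' T' : Type*} [Fintype S'] [Fintype T'] (f : A₁ → S' → ℂ) (g : B₁ → T' → ℂ) :
    normSq (fun x : A₁ × B₁ × (S' × T') => f x.1 x.2.2.1 * g x.2.1 x.2.2.2)
      = (∑ a, ∑ s, ‖f a s‖ ^ 2) * ∑ b, ∑ t, ‖g b t‖ ^ 2 := by
  simp only [normSq, Fintype.sum_prod_type, norm_mul, mul_pow]
  rw [Finset.sum_mul]
  refine Finset.sum_congr rfl fun a _ => ?_
  rw [Finset.mul_sum]
  refine Finset.sum_congr rfl fun b _ => ?_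
  rw [Finset.sum_mul_sum]

variable [DecidableEq A₁] [DecidableEq B₁]

lemma sum_normSq_localAct {X : ι → Matrix A₂ A₁ ℂ} {Y : ι → Matrix B₂ B₁ ℂ}
    (h : IsIsometric fun i => X i ⊗ₖ Y i) (v : A₁ × B₁ × S → ℂ) :
    ∑ i, normSq (localAct (X i) (Y i) v) = normSq v := by
  simp_rw [normSq_prod_assoc]
  rw [Finset.sum_comm]
  exact Finset.sum_congr rfl fun s _ => h.sum_sq fun y => v (y.1, y.2, s)

/-- Cauchy–Schwarz for each `i`, then conservation of the norm. This controls every approximation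
below: replacing a vector by another costs at most the squared distance times the squared norm of
the opposite vector. -/
lemma sum_sq_amplitude_le {X : ι → Matrix A₂ A₁ ℂ} {Y : ι → Matrix B₂ B₁ ℂ}
    (h : IsIsometric fun i => X i ⊗ₖ Y i) (u : A₂ × B₂ × S → ℂ) (v : A₁ × B₁ × S → ℂ) :
    ∑ i, ‖amplitude (X i) (Y i) u v‖ ^ 2 ≤ normSq u * normSq v := by
  rw [← sum_normSq_localAct h v, Finset.mul_sum]
  refine Finset.sum_le_sum fun i _ => ?_
  refine (sq_norm_sum_mul_le _ _).trans (le_of_eq ?_)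
  simp [normSq]

/-- Frobenius norms of the two sides of an isometric product family. -/
lemma sum_frobenius_mul {X : ι → Matrix A₂ A₁ ℂ} {Y : ι → Matrix B₂ B₁ ℂ}
    (h : IsIsometric fun i => X i ⊗ₖ Y i) {S' T' : Type*} [Fintype S'] [Fintype T']
    (G : A₁ → S' → ℂ) (H : B₁ → T' → ℂ) :
    ∑ i, (∑ c, ∑ s, ‖∑ a, X i c a * G a s‖ ^ 2) * (∑ d, ∑ t, ‖∑ b, Y i d b * H b t‖ ^ 2)
      = (∑ a, ∑ s, ‖G a s‖ ^ 2) * ∑ b, ∑ t, ‖H b t‖ ^ 2 := by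
  have h1 := sum_normSq_localAct h (S := S' × T') fun x => G x.1 x.2.2.1 * H x.2.1 x.2.2.2
  have e2 : ∀ i, localAct (X i) (Y i)
      (fun x : A₁ × B₁ × (S' × T') => G x.1 x.2.2.1 * H x.2.1 x.2.2.2)
      = fun x => (∑ a, X i x.1 a * G a x.2.2.1) * ∑ b, Y i x.2.1 b * H b x.2.2.2 := by
    intro i
    funext x
    rw [sum_mul_sum_prod]
    exact Finset.sum_congr rfl fun y _ => by rw [Matrix.kroneckerMap_apply]; ring
  simp_rw [e2] at h1
  rw [← normSq_mul, ← h1]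
  refine Finset.sum_congr rfl fun i _ => ?_
  exact (normSq_mul (fun c s => ∑ a, X i c a * G a s) fun d t => ∑ b, Y i d b * H b t).symm

/-- The amplitudes of product operators between a vector that factors through the cut `AW : BE`
and a vector whose marginal on that cut is bounded by `β`. -/
lemma sum_sq_amplitude_cut_le {X : ι → Matrix A₂ A₁ ℂ} {Y : ι → Matrix B₂ B₁ ℂ}
    (h : IsIsometric fun i => X i ⊗ₖ Y i) {W E Q : Type*} [Fintype W] [Fintype E] [Fintype Q]
    (u : A₂ × B₂ × (W × E) → ℂ) (β : ℝ)
    (hu : ∀ x : A₂ × W → ℂ, ∑ z : B₂ × E, ‖∑ y : A₂ × W, star (u (y.1, z.1, y.2, z.2)) * x y‖ ^ 2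
      ≤ β * ∑ y, ‖x y‖ ^ 2)
    (G : A₁ → W × Q → ℂ) (H : B₁ → E × Q → ℂ) :
    ∑ i, ‖amplitude (X i) (Y i) u
        (fun x => ∑ q, G x.1 (x.2.2.1, q) * H x.2.1 (x.2.2.2, q))‖ ^ 2
      ≤ β * ((∑ a, ∑ s, ‖G a s‖ ^ 2) * ∑ b, ∑ t, ‖H b t‖ ^ 2) := by
  rw [← sum_frobenius_mul h, Finset.mul_sum]
  refine Finset.sum_le_sum fun i _ => ?_
  set XG : A₂ → W × Q → ℂ := fun c s => ∑ a, X i c a * G a s with hXG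
  set YH : B₂ → E × Q → ℂ := fun d t => ∑ b, Y i d b * H b t with hYH
  -- Regroup the amplitude along the cut `AW : BE`, with `q` the index contracted between the
  -- factors of the right vector. Cauchy–Schwarz then splits off `YH`, and `hu` bounds what remains.
  have h1 : amplitude (X i) (Y i) u (fun x => ∑ q, G x.1 (x.2.2.1, q) * H x.2.1 (x.2.2.2, q))
      = ∑ z : Q × (B₂ × E), (∑ y : A₂ × W, star (u (y.1, z.2.1, y.2, z.2.2)) * XG y.1 (y.2, z.1))
        * YH z.2.1 (z.2.2, z.1) := by
    have h2 : ∀ x : A₂ × B₂ × (W × E), localAct (X i) (Y i)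
        (fun x => ∑ q, G x.1 (x.2.2.1, q) * H x.2.1 (x.2.2.2, q)) x
        = ∑ q, XG x.1 (x.2.2.1, q) * YH x.2.1 (x.2.2.2, q) := by
      intro x
      have h3 : ∀ q, XG x.1 (x.2.2.1, q) * YH x.2.1 (x.2.2.2, q)
          = ∑ y : A₁ × B₁, (X i ⊗ₖ Y i) (x.1, x.2.1) y
            * (G y.1 (x.2.2.1, q) * H y.2 (x.2.2.2, q)) := by
        intro q
        rw [hXG, hYH, sum_mul_sum_prod]
        exact Finset.sum_congr rfl fun y _ => by rw [Matrix.kroneckerMap_apply]; ring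
      simp_rw [h3]
      rw [Finset.sum_comm]
      exact Finset.sum_congr rfl fun y _ => by rw [← Finset.mul_sum]
    simp only [amplitude, h2]
    simp only [Fintype.sum_prod_type, Finset.mul_sum, Finset.sum_mul]
    have h3 : ∀ c, ∑ d, ∑ w, ∑ e, ∑ q, star (u (c, d, w, e)) * (XG c (w, q) * YH d (e, q))
        = ∑ q, ∑ d, ∑ e, ∑ w, star (u (c, d, w, e)) * XG c (w, q) * YH d (e, q) := by
      intro c
      have h4 : ∀ d, ∑ w, ∑ e, ∑ q, star (u (c, d, w, e)) * (XG c (w, q) * YH d (e, q))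
          = ∑ q, ∑ e, ∑ w, star (u (c, d, w, e)) * XG c (w, q) * YH d (e, q) := by
        intro d
        rw [Finset.sum_comm]
        have h5 : ∀ e, ∑ w, ∑ q, star (u (c, d, w, e)) * (XG c (w, q) * YH d (e, q))
            = ∑ q, ∑ w, star (u (c, d, w, e)) * XG c (w, q) * YH d (e, q) := by
          intro e
          rw [Finset.sum_comm]
          simp_rw [mul_assoc]
        simp_rw [h5]
        exact Finset.sum_comm
      simp_rw [h4]
      exact Finset.sum_comm
    simp_rw [h3]
    rw [Finset.sum_comm]
    refine Finset.sum_congr rfl fun q _ => ?_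
    rw [Finset.sum_comm]
    refine Finset.sum_congr rfl fun d _ => ?_
    rw [Finset.sum_comm]
  rw [h1]
  refine (sq_norm_sum_mul_le _ _).trans ?_
  have h6 : ∑ z : Q × (B₂ × E), ‖YH z.2.1 (z.2.2, z.1)‖ ^ 2 = ∑ d, ∑ t, ‖YH d t‖ ^ 2 := by
    simp only [Fintype.sum_prod_type]
    rw [Finset.sum_comm]
    exact Finset.sum_congr rfl fun d _ => Finset.sum_comm
  have h7 : ∑ z : Q × (B₂ × E), ‖∑ y : A₂ × W,
      star (u (y.1, z.2.1, y.2, z.2.2)) * XG y.1 (y.2, z.1)‖ ^ 2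
      ≤ β * ∑ c, ∑ s, ‖XG c s‖ ^ 2 := by
    rw [Fintype.sum_prod_type]
    refine (Finset.sum_le_sum fun q _ => hu fun y => XG y.1 (y.2, q)).trans (le_of_eq ?_)
    rw [← Finset.mul_sum]
    congr 1
    simp only [Fintype.sum_prod_type]
    rw [Finset.sum_comm]
    exact Finset.sum_congr rfl fun d _ => Finset.sum_comm
  rw [h6, ← mul_assoc]
  exact mul_le_mul_of_nonneg_right h7
    (Finset.sum_nonneg fun _ _ => Finset.sum_nonneg fun _ _ => sq_nonneg _)

end Amplitude

/-! ### Dilating the reference system -/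

section Dilate

variable {A B A' B' R E W : Type*} [Fintype A] [Fintype B] [Fintype A'] [Fintype B'] [Fintype R]
  [Fintype E] [Fintype W] [DecidableEq R]

/-- The blocks of an isometry `R → W ⊗ E`, applied to the reference. -/
def dilate (N : E → Matrix W R ℂ) (v : A × B × R → ℂ) : A × B × (W × E) → ℂ :=
  fun x => ∑ r, N x.2.2.2 x.2.2.1 r * v (x.1, x.2.1, r)

lemma normSq_dilate {N : E → Matrix W R ℂ} (h : IsIsometric N) (v : A × B × R → ℂ) :
    normSq (dilate N v) = normSq v := by
  simp only [normSq, dilate, Fintype.sum_prod_type]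
  refine Finset.sum_congr rfl fun a _ => Finset.sum_congr rfl fun b _ => ?_
  rw [Finset.sum_comm]
  exact h.sum_sq fun r => v (a, b, r)

lemma localAct_dilate (N : E → Matrix W R ℂ) (X : Matrix A' A ℂ) (Y : Matrix B' B ℂ)
    (v : A × B × R → ℂ) : localAct X Y (dilate N v) = dilate N (localAct X Y v) := by
  funext x
  simp only [localAct, dilate, Finset.mul_sum]
  rw [Finset.sum_comm]
  exact Finset.sum_congr rfl fun r _ => Finset.sum_congr rfl fun y _ => by ring

/-- The protocol does not touch the reference, so it commutes with the isometry, which preserves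
inner products. -/
lemma amplitude_dilate {N : E → Matrix W R ℂ} (h : IsIsometric N) (X : Matrix A' A ℂ)
    (Y : Matrix B' B ℂ) (u : A' × B' × R → ℂ) (v : A × B × R → ℂ) :
    amplitude X Y (dilate N u) (dilate N v) = amplitude X Y u v := by
  simp only [amplitude, localAct_dilate]
  simp only [dilate, Fintype.sum_prod_type]
  refine Finset.sum_congr rfl fun a _ => Finset.sum_congr rfl fun b _ => ?_
  rw [Finset.sum_comm]
  exact h.inner_eq (fun r => u (a, b, r)) fun r => localAct X Y v (a, b, r)

end Dilate

/-! ### Adjoining maximally entangled states -/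

lemma sum_sq_norm_maxEnt {K : ℕ} (hK : 0 < K) :
    ∑ k : Fin K, ∑ k' : Fin K, ‖maxEnt K (k, k')‖ ^ 2 = 1 := by
  have h0 : (0 : ℝ) < K := by exact_mod_cast hK
  have h1 : ∀ k k' : Fin K, ‖maxEnt K (k, k')‖ ^ 2 = if k = k' then (K : ℝ)⁻¹ else 0 := by
    intro k k'
    unfold maxEnt
    split_ifs
    · rw [Complex.norm_real, norm_inv, Real.norm_of_nonneg (Real.sqrt_nonneg _), inv_pow,
        Real.sq_sqrt h0.le]
    · simp
  simp_rw [h1]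
  simp [h0.ne']

lemma isUnitVector_maxEnt {L : ℕ} (hL : 0 < L) : IsUnitVector (maxEnt L) := by
  unfold IsUnitVector
  rw [Fintype.sum_prod_type]
  exact sum_sq_norm_maxEnt hL

section Ebits

variable {A B S R E W : Type*} [Fintype A] [Fintype B] [Fintype S] [Fintype R] [Fintype E]
  [Fintype W]

/-- `v ⊗ Φ_K`, with the two halves of `Φ_K` given to the first two parties. -/
def withEbits (K : ℕ) (v : A × B × S → ℂ) : (A × Fin K) × (B × Fin K) × S → ℂ :=
  fun x => v (x.1.1, x.2.1.1, x.2.2) * maxEnt K (x.1.2, x.2.1.2)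

/-- The first two parties exchange their systems. -/
def swapParties (v : A × B × S → ℂ) : B × A × S → ℂ := fun x => v (x.2.1, x.1, x.2.2)

lemma normSq_swapParties (v : A × B × S → ℂ) : normSq (swapParties v) = normSq v := by
  simp only [normSq, swapParties, Fintype.sum_prod_type]
  exact Finset.sum_comm

lemma normSq_withEbits {K : ℕ} (hK : 0 < K) (v : A × B × S → ℂ) :
    normSq (withEbits K v) = normSq v := by
  have h1 : normSq (withEbits K v)
      = ∑ a, ∑ k : Fin K, ∑ b, ∑ k' : Fin K, ∑ s, ‖v (a, b, s)‖ ^ 2 * ‖maxEnt K (k, k')‖ ^ 2 := by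
    simp only [normSq, withEbits, Fintype.sum_prod_type, norm_mul, mul_pow]
  have h2 : normSq v = ∑ a, ∑ b, ∑ s, ‖v (a, b, s)‖ ^ 2 := by
    simp only [normSq, Fintype.sum_prod_type]
  rw [h1, h2]
  refine Finset.sum_congr rfl fun a _ => ?_
  rw [Finset.sum_comm]
  refine Finset.sum_congr rfl fun b _ => ?_
  simp_rw [← Finset.sum_mul, ← Finset.mul_sum]
  rw [sum_sq_norm_maxEnt hK, mul_one]

lemma withEbits_sub (K : ℕ) (v v' : A × B × S → ℂ) :
    withEbits K (v - v') = withEbits K v - withEbits K v' := by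
  funext x
  simp [withEbits, sub_mul]

lemma dilate_withEbits (N : E → Matrix W R ℂ) (K : ℕ) (v : A × B × R → ℂ) :
    dilate N (withEbits K v) = withEbits K (dilate N v) := by
  funext x
  simp only [dilate, withEbits, Finset.sum_mul, mul_assoc]

lemma dilate_swapParties (N : E → Matrix W R ℂ) (v : A × B × R → ℂ) :
    dilate N (swapParties v) = swapParties (dilate N v) := rfl

end Ebits

/-! ### Fidelity of a protocol -/

lemma fidelity_runLOCC {A B A' B' R : Type} [Fintype A] [Fintype B] [Fintype A'] [Fintype B']
    [Fintype R] [DecidableEq A'] [DecidableEq B'] [DecidableEq R]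
    (T : List (Matrix A' A ℂ × Matrix B' B ℂ)) (φ : A × B × R → ℂ) (τ : A' × B' × R → ℂ)
    (hτ : IsUnitVector τ) :
    fidelity (runLOCC T (proj φ)) (proj τ)
      = Real.sqrt (∑ i : Fin T.length, ‖amplitude T[i].1 T[i].2 τ φ‖ ^ 2) := by
  refine fidelity_proj hτ _ _ (Finset.sum_nonneg fun _ _ => sq_nonneg _) ?_
  have h1 : ∀ i : Fin T.length, amplitude T[i].1 T[i].2 τ φ
      = star τ ⬝ᵥ (T[i].1 ⊗ₖ (T[i].2 ⊗ₖ (1 : Matrix R R ℂ))).mulVec φ := by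
    intro i
    refine Finset.sum_congr rfl fun x _ => ?_
    congr 1
    simp only [localAct, Matrix.mulVec, dotProduct, Matrix.kroneckerMap_apply,
      Fintype.sum_prod_type, Matrix.one_apply]
    refine Finset.sum_congr rfl fun a _ => Finset.sum_congr rfl fun b _ => ?_
    simp
  simp_rw [h1]
  rw [runLOCC, ← Fin.sum_univ_fun_getElem, Matrix.sum_mulVec, dotProduct_sum]
  push_cast
  refine Finset.sum_congr rfl fun i _ => ?_
  rw [proj, dotProduct_kraus_proj]
  push_cast
  rfl

/-! ### Spectral truncation -/

/-- `P` is a projection of trace at most `r` that changes `M` by at most `η`, and such that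
`(P M) (P M)ᴴ ≤ β`. -/
structure IsTruncation {X Y : Type*} [Fintype X] [Fintype Y] (P : Matrix X X ℂ) (M : Matrix X Y ℂ)
    (η β r : ℝ) : Prop where
  hermitian : P.conjTranspose = P
  idempotent : P * P = P
  close : ∑ x, ∑ y, ‖M x y - (P * M) x y‖ ^ 2 ≤ η
  bound : ∀ z : X → ℂ, ∑ y, ‖∑ x, star ((P * M) x y) * z x‖ ^ 2 ≤ β * ∑ x, ‖z x‖ ^ 2
  trace_le : ∑ x, ∑ x', ‖P x x'‖ ^ 2 ≤ r

/-- The marginal of `Φ_L` is `1 / L`, so adjoining it divides the bound on the marginal by `L`. -/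
lemma sum_sq_star_maxEnt_le {P Q : Type*} [Fintype P] [Fintype Q] {L : ℕ} (β : ℝ)
    (M : Matrix P Q ℂ)
    (h : ∀ z : P → ℂ, ∑ y, ‖∑ x, star (M x y) * z x‖ ^ 2 ≤ β * ∑ x, ‖z x‖ ^ 2)
    (z : P → Fin L → ℂ) :
    ∑ y, ∑ l', ‖∑ x, ∑ l, star (M x y * maxEnt L (l, l')) * z x l‖ ^ 2
      ≤ β / L * ∑ x, ∑ l, ‖z x l‖ ^ 2 := by
  have h1 : ∀ y (l' : Fin L), ‖∑ x, ∑ l, star (M x y * maxEnt L (l, l')) * z x l‖ ^ 2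
      = (L : ℝ)⁻¹ * ‖∑ x, star (M x y) * z x l'‖ ^ 2 := by
    intro y l'
    have h2 : ∑ x, ∑ l, star (M x y * maxEnt L (l, l')) * z x l
        = (((Real.sqrt L)⁻¹ : ℝ) : ℂ) * ∑ x, star (M x y) * z x l' := by
      rw [Finset.mul_sum]
      refine Finset.sum_congr rfl fun x _ => ?_
      rw [Finset.sum_eq_single l' (fun l _ hl => by simp [maxEnt, hl]) (by simp)]
      simp only [maxEnt, if_true, star_mul', Complex.star_def, Complex.conj_ofReal]
      ring
    rw [h2, norm_mul, mul_pow, Complex.norm_real, norm_inv,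
      Real.norm_of_nonneg (Real.sqrt_nonneg _), inv_pow, Real.sq_sqrt (Nat.cast_nonneg L)]
  simp_rw [h1]
  rw [Finset.sum_comm]
  simp_rw [← Finset.mul_sum]
  rw [div_eq_mul_inv, mul_comm β, mul_assoc]
  refine mul_le_mul_of_nonneg_left ?_ (by positivity)
  rw [Finset.sum_comm (s := (Finset.univ : Finset P)), Finset.mul_sum]
  exact Finset.sum_le_sum fun l _ => h fun x => z x l

lemma normSq_le_of_sub {ι : Type*} [Fintype ι] (u u' : ι → ℂ) {η : ℝ} (h : normSq (u - u') ≤ η) :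
    normSq u' ≤ 2 * normSq u + 2 * η := by
  have h1 := normSq_add_le u (u' - u)
  have h2 : normSq (u' - u) = normSq (u - u') := by simp [normSq, norm_sub_rev]
  rw [add_sub_cancel, h2] at h1
  linarith

/-! ### One-shot bound for a cut through the reference. -/

section Cut

variable {A B R E W ι : Type*} [Fintype A] [Fintype B] [Fintype R] [Fintype E] [Fintype W]
  [Fintype ι] [DecidableEq A] [DecidableEq B] [DecidableEq R]

/-- Separable exchange of the two parties' systems, when part `W` of the reference is counted with
the first party. -/
theorem sum_sq_exchange_cut_le {K L : ℕ} (hK : 0 < K) (hL : 0 < L)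
    {X : ι → Matrix (B × Fin L) (A × Fin K) ℂ} {Y : ι → Matrix (A × Fin L) (B × Fin K) ℂ}
    (h : IsIsometric fun i => X i ⊗ₖ Y i) {φ : A × B × R → ℂ} (hφ : normSq φ = 1)
    {N : E → Matrix W R ℂ} (hN : IsIsometric N)
    {P : Matrix (A × W) (A × W) ℂ} {Q : Matrix (B × W) (B × W) ℂ} {η β β' r r' : ℝ}
    (hη : η ≤ 1) (hβ : 0 ≤ β)
    (hP : IsTruncation P (fun p q => dilate N φ (p.1, q.1, p.2, q.2) : Matrix (A × W) (B × E) ℂ)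
      η β' r)
    (hQ : IsTruncation Q (fun p q => dilate N φ (q.1, p.1, p.2, q.2) : Matrix (B × W) (A × E) ℂ)
      η β r') :
    ∑ i, ‖amplitude (X i) (Y i) (withEbits L (swapParties φ)) (withEbits K φ)‖ ^ 2
      ≤ 3 * (K / L * (r * β)) + 15 * η := by
  set M₁ : Matrix (A × W) (B × E) ℂ := fun p q => dilate N φ (p.1, q.1, p.2, q.2) with hM₁
  set M₂ : Matrix (B × W) (A × E) ℂ := fun p q => dilate N φ (q.1, p.1, p.2, q.2) with hM₂
  set v := withEbits K (dilate N φ) with hv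
  set u := withEbits L (swapParties (dilate N φ)) with hu
  set v₀ : A × B × (W × E) → ℂ := fun x => (P * M₁) (x.1, x.2.2.1) (x.2.1, x.2.2.2) with hv₀
  set u₀ : B × A × (W × E) → ℂ := fun x => (Q * M₂) (x.1, x.2.2.1) (x.2.1, x.2.2.2) with hu₀
  have hamp : ∀ i, amplitude (X i) (Y i) (withEbits L (swapParties φ)) (withEbits K φ)
      = amplitude (X i) (Y i) u v := by
    intro i
    rw [← amplitude_dilate hN, dilate_withEbits, dilate_withEbits, dilate_swapParties]
  have hvn : normSq v = 1 := by rw [hv, normSq_withEbits hK, normSq_dilate hN, hφ]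
  have hun : normSq u = 1 := by
    rw [hu, normSq_withEbits hL, normSq_swapParties, normSq_dilate hN, hφ]
  have hvd : normSq (v - withEbits K v₀) ≤ η := by
    rw [hv, ← withEbits_sub, normSq_withEbits hK]
    refine le_trans (le_of_eq ?_) hP.close
    simp only [normSq, Fintype.sum_prod_type]
    refine Finset.sum_congr rfl fun a _ => ?_
    rw [Finset.sum_comm]
    rfl
  have hud : normSq (u - withEbits L u₀) ≤ η := by
    rw [hu, ← withEbits_sub, normSq_withEbits hL]
    refine le_trans (le_of_eq ?_) hQ.close
    simp only [normSq, Fintype.sum_prod_type]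
    refine Finset.sum_congr rfl fun a _ => ?_
    rw [Finset.sum_comm]
    rfl
  -- The crude value is `2 * 1 + 2 * η` with `η ≤ 1`. It makes the two error terms `3 * 4η` and `3 *
  -- η`, in total `15η`.
  have hu₀n : normSq (withEbits L u₀) ≤ 4 := by
    have := normSq_le_of_sub _ _ hud
    linarith
  have hη0 : 0 ≤ η := (normSq_nonneg _).trans hvd
  have h2 : ∑ i, ‖amplitude (X i) (Y i) (withEbits L u₀) (v - withEbits K v₀)‖ ^ 2 ≤ 4 * η :=
    (sum_sq_amplitude_le h _ _).trans
      (mul_le_mul hu₀n hvd (normSq_nonneg _) (by norm_num))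
  have h3 : ∑ i, ‖amplitude (X i) (Y i) (u - withEbits L u₀) v‖ ^ 2 ≤ η := by
    refine (sum_sq_amplitude_le h _ _).trans ?_
    rw [hvn, mul_one]
    exact hud
  have h1 : ∑ i, ‖amplitude (X i) (Y i) (withEbits L u₀) (withEbits K v₀)‖ ^ 2
      ≤ K / L * (r * β) := by
    -- The truncated input is `P M₁ ⊗ Φ_K`, factored as `P ⊗ 1_K` times `M₁ ⊗ Φ_K` with contraction
    -- index in `(A × W) × Fin K`. The first factor has squared norm `K * Tr P ≤ K * r`; the second
    -- carries a unit vector.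
    set G : A × Fin K → W × ((A × W) × Fin K) → ℂ :=
      fun a s => P (a.1, s.1) s.2.1 * if a.2 = s.2.2 then 1 else 0 with hG
    set H : B × Fin K → E × ((A × W) × Fin K) → ℂ :=
      fun b t => M₁ t.2.1 (b.1, t.1) * maxEnt K (t.2.2, b.2) with hH
    have hfac : withEbits K v₀ = fun x => ∑ q, G x.1 (x.2.2.1, q) * H x.2.1 (x.2.2.2, q) := by
      funext x
      simp only [withEbits, hv₀, Matrix.mul_apply, Finset.sum_mul]
      rw [Fintype.sum_prod_type (α₁ := A × W)]
      refine Finset.sum_congr rfl fun t _ => ?_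
      rw [Finset.sum_eq_single x.1.2 (fun k _ hk => by simp [hG, Ne.symm hk]) (by simp)]
      simp [hG, hH, mul_assoc]
    have hcut := sum_sq_amplitude_cut_le h (withEbits L u₀) (β / L) ?_ G H
    · rw [hfac]
      refine hcut.trans ?_
      have hGn : ∑ a, ∑ s, ‖G a s‖ ^ 2 ≤ K * r := by
        refine le_trans (le_of_eq ?_) (mul_le_mul_of_nonneg_left hP.trace_le (Nat.cast_nonneg K))
        have : ∀ a s, ‖G a s‖ ^ 2 = ‖P (a.1, s.1) s.2.1‖ ^ 2 * if a.2 = s.2.2 then 1 else 0 := by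
          intro a s
          simp only [hG, norm_mul, mul_pow]
          split_ifs <;> simp
        simp_rw [this, Fintype.sum_prod_type]
        simp only [mul_ite, mul_one, mul_zero, Finset.sum_ite_eq, Finset.mem_univ, if_true,
          Finset.sum_const, Finset.card_univ, Fintype.card_fin, nsmul_eq_mul]
        rw [← Finset.mul_sum]
      have hHn : ∑ b, ∑ t, ‖H b t‖ ^ 2 = 1 := by
        rw [← hvn, hv, normSq_withEbits hK]
        have h4 : ∑ b, ∑ t, ‖H b t‖ ^ 2 = ∑ b, ∑ k' : Fin K, ∑ e, ∑ a, ∑ w, ∑ k : Fin K,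
            ‖dilate N φ (a, b, w, e)‖ ^ 2 * ‖maxEnt K (k, k')‖ ^ 2 := by
          simp only [hH, hM₁, Fintype.sum_prod_type, norm_mul, mul_pow]
        have h5 : normSq (dilate N φ) = ∑ a, ∑ b, ∑ w, ∑ e, ‖dilate N φ (a, b, w, e)‖ ^ 2 := by
          simp only [normSq, Fintype.sum_prod_type]
        have h6 : ∑ k' : Fin K, ∑ k : Fin K, ‖maxEnt K (k, k')‖ ^ 2 = 1 := by
          rw [Finset.sum_comm]; exact sum_sq_norm_maxEnt hK
        rw [h4, h5, Finset.sum_comm (s := (Finset.univ : Finset A))]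
        refine Finset.sum_congr rfl fun b _ => ?_
        simp_rw [← Finset.mul_sum, ← Finset.sum_mul]
        rw [← Finset.mul_sum, h6, mul_one, Finset.sum_comm]
        exact Finset.sum_congr rfl fun a _ => Finset.sum_comm
      rw [hHn, mul_one]
      have hL' : (0 : ℝ) < L := by exact_mod_cast hL
      calc β / L * ∑ a, ∑ s, ‖G a s‖ ^ 2 ≤ β / L * (K * r) :=
            mul_le_mul_of_nonneg_left hGn (by positivity)
        _ = K / L * (r * β) := by ring
    · intro x
      have := sum_sq_star_maxEnt_le (L := L) β (Q * M₂) hQ.bound fun p l => x ((p.1, l), p.2)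
      simp only [Fintype.sum_prod_type, withEbits, hu₀] at this ⊢
      have e1 : ∑ a, ∑ l', ∑ e, ‖∑ b, ∑ l, ∑ w, star ((Q * M₂) (b, w) (a, e) * maxEnt L (l, l'))
          * x ((b, l), w)‖ ^ 2 = ∑ a, ∑ e, ∑ l', ‖∑ b, ∑ w, ∑ l,
          star ((Q * M₂) (b, w) (a, e) * maxEnt L (l, l')) * x ((b, l), w)‖ ^ 2 := by
        refine Finset.sum_congr rfl fun a _ => ?_
        rw [Finset.sum_comm]
        refine Finset.sum_congr rfl fun e _ => Finset.sum_congr rfl fun l' _ => ?_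
        congr 2
        exact Finset.sum_congr rfl fun b _ => Finset.sum_comm
      have e2 : ∑ b, ∑ l, ∑ w, ‖x ((b, l), w)‖ ^ 2 = ∑ b, ∑ w, ∑ l, ‖x ((b, l), w)‖ ^ 2 :=
        Finset.sum_congr rfl fun b _ => Finset.sum_comm
      rw [e1, e2]
      exact this
  simp_rw [hamp]
  calc _ ≤ ∑ i, (3 * ‖amplitude (X i) (Y i) (withEbits L u₀) (withEbits K v₀)‖ ^ 2
        + 3 * ‖amplitude (X i) (Y i) (withEbits L u₀) (v - withEbits K v₀)‖ ^ 2
        + 3 * ‖amplitude (X i) (Y i) (u - withEbits L u₀) v‖ ^ 2) :=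
        Finset.sum_le_sum fun i _ => sq_norm_amplitude_le _ _ _ _ _ _
    _ ≤ _ := by
        simp only [Finset.sum_add_distrib, ← Finset.mul_sum]
        linarith

end Cut

lemma sum_four_comm {M A B C D : Type*} [AddCommMonoid M] [Fintype A] [Fintype B] [Fintype C]
    [Fintype D] (f : A → B → C → D → M) :
    ∑ a, ∑ b, ∑ c, ∑ d, f a b c d = ∑ d, ∑ b, ∑ a, ∑ c, f a b c d := by
  have h1 : ∀ a b, ∑ c, ∑ d, f a b c d = ∑ d, ∑ c, f a b c d := fun a b => Finset.sum_comm
  simp_rw [h1]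
  have h2 : ∀ a, ∑ b, ∑ d, ∑ c, f a b c d = ∑ d, ∑ b, ∑ c, f a b c d := fun a => Finset.sum_comm
  simp_rw [h2]
  rw [Finset.sum_comm]
  exact Finset.sum_congr rfl fun d _ => Finset.sum_comm

/-! ### Vectors obtained by distillation with the reference -/

section Distill

variable {A B R E : Type*} [Fintype A] [Fintype B] [Fintype R] [Fintype E] [DecidableEq A]
  [DecidableEq B] [DecidableEq R] {ℓ : ℕ} {J : E → Type*} [∀ e, Fintype (J e)]

/-- The unnormalized state of the third party after the reference and the first party have been
found in `Φ_ℓ`; the operators applied before are `N e` and `D e j`. -/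
def distillRest (N : E → Matrix (Fin ℓ) R ℂ) (D : ∀ e, J e → Matrix (Fin ℓ) A ℂ)
    (φ : A × B × R → ℂ) (e : E) (j : J e) (b : B) : ℂ :=
  (((Real.sqrt ℓ)⁻¹ : ℝ) : ℂ) * ∑ w, ∑ a, D e j w a * dilate N φ (a, b, w, e)

/-- The part of `dilate N φ` for which the distillation succeeds. -/
def distillPart (N : E → Matrix (Fin ℓ) R ℂ) (D : ∀ e, J e → Matrix (Fin ℓ) A ℂ)
    (φ : A × B × R → ℂ) : A × B × (Fin ℓ × E) → ℂ :=
  fun x => (((Real.sqrt ℓ)⁻¹ : ℝ) : ℂ) *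
    ∑ j, star (D x.2.2.2 j x.2.2.1 x.1) * distillRest N D φ x.2.2.2 j x.2.1

variable {N : E → Matrix (Fin ℓ) R ℂ} {D : ∀ e, J e → Matrix (Fin ℓ) A ℂ}

lemma sq_norm_inv_sqrt (n : ℕ) : ‖(((Real.sqrt n)⁻¹ : ℝ) : ℂ)‖ ^ 2 = (n : ℝ)⁻¹ := by
  rw [Complex.norm_real, norm_inv, Real.norm_of_nonneg (Real.sqrt_nonneg _), inv_pow,
    Real.sq_sqrt (Nat.cast_nonneg n)]

/-- For fixed `e` the operators `D e j` form an isometry `V`. Then `distillPart` is `Vᴴ` applied to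
`∑ⱼ Φ_ℓ ⊗ |j⟩ ⊗ distillRest`, and the adjoint of an isometry is a contraction. -/
lemma sum_sq_distillPart_le (hℓ : 0 < ℓ) (hD : ∀ e, IsIsometric (D e)) (φ : A × B × R → ℂ) :
    normSq (distillPart N D φ) ≤ ∑ e, ∑ j, ∑ b, ‖distillRest N D φ e j b‖ ^ 2 := by
  have h0 : (0 : ℝ) < ℓ := by exact_mod_cast hℓ
  have h1 : normSq (distillPart N D φ) = ∑ e, ∑ b, ∑ w, (ℓ : ℝ)⁻¹ *
      ∑ a, ‖∑ j, star (D e j w a) * distillRest N D φ e j b‖ ^ 2 := by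
    simp only [normSq, distillPart, Fintype.sum_prod_type, norm_mul, mul_pow, sq_norm_inv_sqrt]
    rw [sum_four_comm]
    refine Finset.sum_congr rfl fun e _ => Finset.sum_congr rfl fun b _ => ?_
    rw [Finset.sum_comm]
    simp only [Finset.mul_sum]
  rw [h1]
  refine Finset.sum_le_sum fun e _ => ?_
  rw [Finset.sum_comm (s := (Finset.univ : Finset (J e)))]
  refine Finset.sum_le_sum fun b _ => ?_
  have h2 : ∀ w, ∑ a, ‖∑ j, star (D e j w a) * distillRest N D φ e j b‖ ^ 2
      ≤ ∑ j, ‖distillRest N D φ e j b‖ ^ 2 := by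
    intro w
    -- The contraction is applied to the vector supported on the single reference index `w`; the
    -- average over `w` then absorbs `ℓ⁻¹`.
    have := (hD e).sum_sq_adjoint_le fun j w' => if w' = w then distillRest N D φ e j b else 0
    simpa [apply_ite] using this
  calc _ ≤ ∑ _w : Fin ℓ, (ℓ : ℝ)⁻¹ * ∑ j, ‖distillRest N D φ e j b‖ ^ 2 :=
        Finset.sum_le_sum fun w _ => mul_le_mul_of_nonneg_left (h2 w) (by positivity)
    _ = _ := by
        rw [Finset.sum_const, Finset.card_univ, Fintype.card_fin, nsmul_eq_mul, ← mul_assoc,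
          mul_inv_cancel₀ h0.ne', one_mul]

/-- For each `e`, `distillPart` is `Vᴴ Π V` applied to the dilated vector, with `Π` the projection
onto `Φ_ℓ`. Its overlap with that vector is therefore the success probability of the distillation.
-/
lemma sum_star_distillPart_mul (φ : A × B × R → ℂ) :
    ∑ x, star (distillPart N D φ x) * dilate N φ x
      = ((∑ e, ∑ j, ∑ b, ‖distillRest N D φ e j b‖ ^ 2 : ℝ) : ℂ) := by
  push_cast
  simp only [Fintype.sum_prod_type]
  have h1 : ∀ e b, ∑ a, ∑ w, star (distillPart N D φ (a, b, w, e)) * dilate N φ (a, b, w, e)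
      = ∑ j, (‖distillRest N D φ e j b‖ : ℂ) ^ 2 := by
    intro e b
    have h2 : ∀ j, (‖distillRest N D φ e j b‖ : ℂ) ^ 2 = ∑ a, ∑ w,
        star (distillRest N D φ e j b) * ((((Real.sqrt ℓ)⁻¹ : ℝ) : ℂ) *
        (D e j w a * dilate N φ (a, b, w, e))) := by
      intro j
      rw [← Complex.conj_mul', Finset.sum_comm]
      conv_lhs => rw [distillRest]
      simp only [← Finset.mul_sum]
      rfl
    simp_rw [h2]
    refine Eq.trans ?_ Finset.sum_comm
    refine Finset.sum_congr rfl fun a _ => ?_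
    refine Eq.trans ?_ Finset.sum_comm
    refine Finset.sum_congr rfl fun w _ => ?_
    simp only [distillPart, star_mul', star_sum, Finset.mul_sum, Finset.sum_mul,
      Complex.star_def, Complex.conj_ofReal, Complex.conj_conj]
    exact Finset.sum_congr rfl fun j _ => by ring
  rw [sum_four_comm]
  simp_rw [h1]
  exact Finset.sum_congr rfl fun e _ => Finset.sum_comm

lemma normSq_sub_eq {ι : Type*} [Fintype ι] (u v : ι → ℂ) :
    normSq (u - v) = normSq u + normSq v - 2 * (∑ i, star (v i) * u i).re := by
  simp only [normSq, Complex.re_sum, Finset.mul_sum, ← Finset.sum_add_distrib,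
    ← Finset.sum_sub_distrib]
  refine Finset.sum_congr rfl fun i _ => ?_
  rw [Pi.sub_apply, ← Complex.normSq_eq_norm_sq, ← Complex.normSq_eq_norm_sq,
    ← Complex.normSq_eq_norm_sq, Complex.normSq_sub, Complex.star_def, mul_comm (u i)]

/-- With success probability `s`, the squared distance is `‖φ‖² + ‖distillPart‖² - 2s`, where
`‖distillPart‖² ≤ s`. -/
lemma normSq_dilate_sub_distillPart_le (hℓ : 0 < ℓ) (hN : IsIsometric N)
    (hD : ∀ e, IsIsometric (D e)) (φ : A × B × R → ℂ) :
    normSq (dilate N φ - distillPart N D φ)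
      ≤ normSq φ - ∑ e, ∑ j, ∑ b, ‖distillRest N D φ e j b‖ ^ 2 := by
  rw [normSq_sub_eq, sum_star_distillPart_mul, Complex.ofReal_re, normSq_dilate hN]
  have := sum_sq_distillPart_le (N := N) hℓ hD φ
  linarith

/-- The third party's states after distillation sum up to at most its initial state. -/
lemma sum_sq_distillRest_le (hℓ : 0 < ℓ) (hN : IsIsometric N) (hD : ∀ e, IsIsometric (D e))
    (φ : A × B × R → ℂ) (z : B → ℂ) :
    ∑ e, ∑ j, ‖∑ b, star (distillRest N D φ e j b) * z b‖ ^ 2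
      ≤ ∑ y : A × R, ‖∑ b, star (φ (y.1, b, y.2)) * z b‖ ^ 2 := by
  have h0 : (0 : ℝ) < ℓ := by exact_mod_cast hℓ
  set g : A → R → ℂ := fun a r => ∑ b, star (z b) * φ (a, b, r) with hg
  set k : E → Fin ℓ → A → ℂ := fun e w a => ∑ r, N e w r * g a r with hk
  have hstar : ∀ {y z : B → ℂ}, ‖∑ b, star (y b) * z b‖ = ‖∑ b, star (z b) * y b‖ := by
    intro y z
    rw [← norm_star, star_sum]
    congr 1
    exact Finset.sum_congr rfl fun b _ => by rw [star_mul', star_star, mul_comm]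
  have h1 : ∀ e j, ∑ b, star (z b) * distillRest N D φ e j b
      = (((Real.sqrt ℓ)⁻¹ : ℝ) : ℂ) * ∑ w, ∑ a, D e j w a * k e w a := by
    intro e j
    simp only [distillRest, hk, hg, dilate, Finset.mul_sum]
    rw [Finset.sum_comm]
    refine Finset.sum_congr rfl fun w _ => ?_
    rw [Finset.sum_comm]
    refine Finset.sum_congr rfl fun a _ => ?_
    rw [Finset.sum_comm]
    exact Finset.sum_congr rfl fun r _ => Finset.sum_congr rfl fun b _ => by ring
  have h2 : ∀ e j, ‖∑ b, star (distillRest N D φ e j b) * z b‖ ^ 2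
      ≤ ∑ w, ‖∑ a, D e j w a * k e w a‖ ^ 2 := by
    intro e j
    rw [hstar, h1, norm_mul, mul_pow, sq_norm_inv_sqrt]
    -- Cauchy–Schwarz against the constant vector costs a factor `ℓ`, which the normalization of
    -- `Φ_ℓ` compensates.
    have := sq_norm_sum_mul_le (fun _ : Fin ℓ => (1 : ℂ)) fun w => ∑ a, D e j w a * k e w a
    simp only [one_mul, norm_one, one_pow, Finset.sum_const, Finset.card_univ, Fintype.card_fin,
      nsmul_eq_mul, mul_one] at this
    calc _ ≤ (ℓ : ℝ)⁻¹ * (ℓ * ∑ w, ‖∑ a, D e j w a * k e w a‖ ^ 2) :=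
          mul_le_mul_of_nonneg_left this (by positivity)
      _ = _ := by rw [← mul_assoc, inv_mul_cancel₀ h0.ne', one_mul]
  calc _ ≤ ∑ e, ∑ j, ∑ w, ‖∑ a, D e j w a * k e w a‖ ^ 2 :=
        Finset.sum_le_sum fun e _ => Finset.sum_le_sum fun j _ => h2 e j
    _ ≤ ∑ e, ∑ w, ∑ a, ‖k e w a‖ ^ 2 := by
        refine Finset.sum_le_sum fun e _ => ?_
        rw [Finset.sum_comm]
        refine Finset.sum_le_sum fun w _ => ?_
        rw [← (hD e).sum_sq]
        refine Finset.sum_le_sum fun j _ => ?_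
        -- Only the output `w' = w` occurs; adding the other outputs makes the isometry of `D e`
        -- applicable.
        exact Finset.single_le_sum (f := fun w' => ‖∑ a, D e j w' a * k e w a‖ ^ 2)
          (fun _ _ => sq_nonneg _) (Finset.mem_univ w)
    _ = ∑ a, ∑ e, ∑ w, ‖∑ r, N e w r * g a r‖ ^ 2 := by
        have : ∀ e, ∑ w, ∑ a, ‖k e w a‖ ^ 2 = ∑ a, ∑ w, ‖k e w a‖ ^ 2 := fun e => Finset.sum_comm
        simp_rw [this]
        exact Finset.sum_comm
    _ = ∑ a, ∑ r, ‖g a r‖ ^ 2 := Finset.sum_congr rfl fun a _ => hN.sum_sq (g a)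
    _ = _ := by
        rw [Fintype.sum_prod_type]
        refine Finset.sum_congr rfl fun a _ => Finset.sum_congr rfl fun r _ => ?_
        rw [hg, hstar]

/-! ### Exchanging distilled vectors -/

/-- Contraction with `Φ_K` identifies the two ebit indices and leaves a factor `K^{-1/2}`, so the
sum decouples into products of an Alice factor and a Bob factor. It serves for both the input and
the target in `amplitude_distillPart`. -/
lemma sum_mul_maxEnt {J : Type*} [Fintype J] {K : ℕ} (U : A × Fin K → ℂ) (V : B × Fin K → ℂ)
    (f : J → A → ℂ) (χ : J → B → ℂ) :
    ∑ y : (A × Fin K) × (B × Fin K), U y.1 * V y.2 *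
        ((∑ j, f j y.1.1 * χ j y.2.1) * maxEnt K (y.1.2, y.2.2))
      = (((Real.sqrt K)⁻¹ : ℝ) : ℂ) * ∑ z : J × Fin K,
        (∑ a, U (a, z.2) * f z.1 a) * ∑ b, V (b, z.2) * χ z.1 b := by
  have h1 : ∀ z : J × Fin K, (∑ a, U (a, z.2) * f z.1 a) * ∑ b, V (b, z.2) * χ z.1 b
      = ∑ a, ∑ b, U (a, z.2) * V (b, z.2) * (f z.1 a * χ z.1 b) := by
    intro z
    rw [Finset.sum_mul_sum]
    exact Finset.sum_congr rfl fun a _ => Finset.sum_congr rfl fun b _ => by ring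
  simp_rw [h1]
  simp only [Fintype.sum_prod_type]
  have h2 : ∀ a (k : Fin K) b, ∑ k' : Fin K, U (a, k) * V (b, k') *
      ((∑ j, f j a * χ j b) * maxEnt K (k, k'))
      = (((Real.sqrt K)⁻¹ : ℝ) : ℂ) * ∑ j, U (a, k) * V (b, k) * (f j a * χ j b) := by
    intro a k b
    rw [Finset.sum_eq_single k (fun k' _ hk => by simp [maxEnt, Ne.symm hk]) (by simp)]
    simp only [maxEnt, if_true, ← Finset.mul_sum]
    ring
  simp_rw [h2]
  simp only [Finset.mul_sum]
  exact sum_four_comm fun a k b j =>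
    (((Real.sqrt K)⁻¹ : ℝ) : ℂ) * (U (a, k) * V (b, k) * (f j a * χ j b))

lemma star_maxEnt {L : ℕ} (x : Fin L × Fin L) : star (maxEnt L x) = maxEnt L x := by
  unfold maxEnt
  split_ifs <;> simp

/-- Both vectors are expanded in products of a decoder row and a leftover state. Alice's factor
joins a decoder row of the input to a leftover state of the target, Bob's factor the reverse, since
the systems are exchanged. -/
lemma amplitude_distillPart {K L : ℕ} (X : Matrix (B × Fin L) (A × Fin K) ℂ)
    (Y : Matrix (A × Fin L) (B × Fin K) ℂ) (φ : A × B × R → ℂ) :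
    amplitude X Y (withEbits L (swapParties (distillPart N D φ)))
        (withEbits K (distillPart N D φ))
      = (((Real.sqrt ℓ)⁻¹ : ℝ) : ℂ) * (((Real.sqrt ℓ)⁻¹ : ℝ) : ℂ) *
        ((((Real.sqrt K)⁻¹ : ℝ) : ℂ) * (((Real.sqrt L)⁻¹ : ℝ) : ℂ)) *
        ∑ s : Fin ℓ × E, ∑ z : J s.2 × Fin K, ∑ z' : J s.2 × Fin L,
          (∑ b, (∑ a, X (b, z'.2) (a, z.2) * star (D s.2 z.1 s.1 a))
            * star (distillRest N D φ s.2 z'.1 b)) *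
          ∑ a, (∑ b, Y (a, z'.2) (b, z.2) * distillRest N D φ s.2 z.1 b) * D s.2 z'.1 s.1 a := by
  set c := (((Real.sqrt ℓ)⁻¹ : ℝ) : ℂ) with hc
  have hcs : star c = c := by simp [hc]
  have h1 : ∀ (s : Fin ℓ × E) (x : (B × Fin L) × (A × Fin L)),
      localAct X Y (withEbits K (distillPart N D φ)) (x.1, x.2, s)
      = c * ((((Real.sqrt K)⁻¹ : ℝ) : ℂ) * ∑ z : J s.2 × Fin K,
        (∑ a, X x.1 (a, z.2) * star (D s.2 z.1 s.1 a)) *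
        ∑ b, Y x.2 (b, z.2) * distillRest N D φ s.2 z.1 b) := by
    intro s x
    have := sum_mul_maxEnt (fun p => X x.1 p) (fun p => Y x.2 p)
      (fun j a => star (D s.2 j s.1 a)) fun j b => distillRest N D φ s.2 j b
    refine Eq.trans ?_ (congrArg (c * ·) this)
    simp only [localAct, Finset.mul_sum (s := (Finset.univ : Finset (_ × _)))]
    refine Finset.sum_congr rfl fun y _ => ?_
    simp only [withEbits, distillPart, Matrix.kroneckerMap_apply]
    ring
  have h2 : amplitude X Y (withEbits L (swapParties (distillPart N D φ)))
        (withEbits K (distillPart N D φ))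
      = ∑ s : Fin ℓ × E, ∑ x : (B × Fin L) × (A × Fin L),
        star (withEbits L (swapParties (distillPart N D φ)) (x.1, x.2, s)) *
        localAct X Y (withEbits K (distillPart N D φ)) (x.1, x.2, s) := by
    rw [amplitude, ← (Equiv.prodAssoc _ _ _).sum_comp, Fintype.sum_prod_type, Finset.sum_comm]
    rfl
  rw [h2, Finset.mul_sum]
  refine Finset.sum_congr rfl fun s _ => ?_
  simp_rw [h1]
  have h3 : ∀ z : J s.2 × Fin K, ∑ x : (B × Fin L) × (A × Fin L),
      (∑ a, X x.1 (a, z.2) * star (D s.2 z.1 s.1 a)) *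
        (∑ b, Y x.2 (b, z.2) * distillRest N D φ s.2 z.1 b) *
      ((∑ j, star (distillRest N D φ s.2 j x.1.1) * D s.2 j s.1 x.2.1) * maxEnt L (x.1.2, x.2.2))
      = _ := fun z => sum_mul_maxEnt (fun p => ∑ a, X p (a, z.2) * star (D s.2 z.1 s.1 a))
        (fun p => ∑ b, Y p (b, z.2) * distillRest N D φ s.2 z.1 b)
        (fun j b => star (distillRest N D φ s.2 j b)) (fun j a => D s.2 j s.1 a)
  have h4 : ∀ x : (B × Fin L) × (A × Fin L),
      star (withEbits L (swapParties (distillPart N D φ)) (x.1, x.2, s))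
      = c * ((∑ j, star (distillRest N D φ s.2 j x.1.1) * D s.2 j s.1 x.2.1)
        * maxEnt L (x.1.2, x.2.2)) := by
    intro x
    simp only [withEbits, swapParties, distillPart, star_mul', star_sum, star_star, star_maxEnt]
    rw [← hc, hcs]
    have : ∀ j, D s.2 j s.1 x.2.1 * star (distillRest N D φ s.2 j x.1.1)
        = star (distillRest N D φ s.2 j x.1.1) * D s.2 j s.1 x.2.1 := fun j => mul_comm _ _
    simp_rw [this]
    ring
  simp_rw [h4]
  have h5 : ∀ x : (B × Fin L) × (A × Fin L),
      c * ((∑ j, star (distillRest N D φ s.2 j x.1.1) * D s.2 j s.1 x.2.1)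
        * maxEnt L (x.1.2, x.2.2)) * (c * ((((Real.sqrt K)⁻¹ : ℝ) : ℂ) * ∑ z : J s.2 × Fin K,
        (∑ a, X x.1 (a, z.2) * star (D s.2 z.1 s.1 a)) *
        ∑ b, Y x.2 (b, z.2) * distillRest N D φ s.2 z.1 b))
      = c * c * (((Real.sqrt K)⁻¹ : ℝ) : ℂ) * ∑ z : J s.2 × Fin K,
        (∑ a, X x.1 (a, z.2) * star (D s.2 z.1 s.1 a)) *
        (∑ b, Y x.2 (b, z.2) * distillRest N D φ s.2 z.1 b) *
        ((∑ j, star (distillRest N D φ s.2 j x.1.1) * D s.2 j s.1 x.2.1)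
        * maxEnt L (x.1.2, x.2.2)) := by
    intro x
    rw [← Finset.sum_mul]
    ring
  simp_rw [h5]
  rw [← Finset.mul_sum, Finset.sum_comm]
  simp_rw [h3]
  rw [← Finset.mul_sum]
  ring

end Distill

/-! ### Local projections -/

/-- Completing a projection by its complement gives an isometric family, so contractivity follows
from `IsIsometric.sum_sq`. -/
lemma IsIsometric.of_projection {X : Type*} [Fintype X] [DecidableEq X] {P : Matrix X X ℂ}
    (hP : P.conjTranspose = P) (hP' : P * P = P) :
    IsIsometric fun i : Bool => cond i P (1 - P) := by
  unfold IsIsometric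
  simp only [Fintype.sum_bool, cond_true, cond_false, Matrix.conjTranspose_sub,
    Matrix.conjTranspose_one, hP, hP', Matrix.sub_mul, Matrix.mul_sub, Matrix.one_mul,
    Matrix.mul_one]
  abel

lemma sum_sq_projection_le {X : Type*} [Fintype X] [DecidableEq X] {P : Matrix X X ℂ}
    (hP : P.conjTranspose = P) (hP' : P * P = P) (g : X → ℂ) :
    ∑ x, ‖∑ y, P x y * g y‖ ^ 2 ≤ ∑ x, ‖g x‖ ^ 2 := by
  rw [← (IsIsometric.of_projection hP hP').sum_sq g, Fintype.sum_bool]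
  exact le_add_of_nonneg_right (Finset.sum_nonneg fun _ _ => sq_nonneg _)

lemma sum_sq_projection_mul_le {X Y : Type*} [Fintype X] [Fintype Y] [DecidableEq X]
    {P : Matrix X X ℂ} (hP : P.conjTranspose = P) (hP' : P * P = P) (M : Matrix X Y ℂ) :
    ∑ x, ∑ y, ‖(P * M) x y‖ ^ 2 ≤ ∑ x, ∑ y, ‖M x y‖ ^ 2 := by
  rw [Finset.sum_comm, Finset.sum_comm (f := fun x y => ‖M x y‖ ^ 2)]
  exact Finset.sum_le_sum fun y _ => sum_sq_projection_le hP hP' fun x => M x y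

section Local

variable {A A₁ A₂ B B₁ B₂ S : Type*} [Fintype A] [Fintype A₁] [Fintype A₂] [Fintype B] [Fintype B₁]
  [Fintype B₂] [Fintype S]

lemma localAct_localAct (X : Matrix A₂ A₁ ℂ) (Y : Matrix B₂ B₁ ℂ) (X' : Matrix A₁ A ℂ)
    (Y' : Matrix B₁ B ℂ) (v : A × B × S → ℂ) :
    localAct X Y (localAct X' Y' v) = localAct (X * X') (Y * Y') v := by
  funext x
  simp only [localAct, Matrix.mul_kronecker_mul, Matrix.mul_apply (m := A₁ × B₁),
    Finset.mul_sum, Finset.sum_mul]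
  rw [Finset.sum_comm]
  exact Finset.sum_congr rfl fun _ _ => Finset.sum_congr rfl fun _ _ => by ring

lemma sum_prod_assoc {M : Type*} [AddCommMonoid M] (f : A × B × S → M) :
    ∑ x, f x = ∑ s, ∑ y : A × B, f (y.1, y.2, s) := by
  rw [← (Equiv.prodAssoc _ _ _).sum_comp, Fintype.sum_prod_type, Finset.sum_comm]
  rfl

lemma amplitude_localAct_left (X : Matrix A₂ A ℂ) (Y : Matrix B₂ B ℂ) (P : Matrix A₂ A₁ ℂ)
    (Q : Matrix B₂ B₁ ℂ) (u : A₁ × B₁ × S → ℂ) (v : A × B × S → ℂ) :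
    amplitude X Y (localAct P Q u) v
      = amplitude (P.conjTranspose * X) (Q.conjTranspose * Y) u v := by
  simp only [amplitude, ← localAct_localAct]
  generalize localAct X Y v = w
  rw [sum_prod_assoc, sum_prod_assoc]
  refine Finset.sum_congr rfl fun s _ => ?_
  simp only [localAct, star_sum, Finset.sum_mul, Finset.mul_sum]
  rw [Finset.sum_comm]
  refine Finset.sum_congr rfl fun y _ => Finset.sum_congr rfl fun x _ => ?_
  rw [← Matrix.conjTranspose_kronecker, Matrix.conjTranspose_apply, star_mul']
  ring

lemma normSq_localAct_projection_le [DecidableEq A] [DecidableEq B] {P : Matrix A A ℂ}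
    {Q : Matrix B B ℂ} (hP : P.conjTranspose = P) (hP' : P * P = P) (hQ : Q.conjTranspose = Q)
    (hQ' : Q * Q = Q) (v : A × B × S → ℂ) : normSq (localAct P Q v) ≤ normSq v := by
  rw [normSq_prod_assoc, normSq_prod_assoc]
  refine Finset.sum_le_sum fun s _ => ?_
  exact sum_sq_projection_le (P := P ⊗ₖ Q) (by rw [Matrix.conjTranspose_kronecker, hP, hQ])
    (by rw [← Matrix.mul_kronecker_mul, hP', hQ']) fun y => v (y.1, y.2, s)

lemma withEbits_localAct (K : ℕ) (X : Matrix A₁ A ℂ) (Y : Matrix B₁ B ℂ) (v : A × B × S → ℂ) :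
    withEbits K (localAct X Y v) = localAct (X ⊗ₖ (1 : Matrix (Fin K) (Fin K) ℂ))
      (Y ⊗ₖ (1 : Matrix (Fin K) (Fin K) ℂ)) (withEbits K v) := by
  funext x
  simp only [withEbits, localAct, Matrix.kroneckerMap_apply, Fintype.sum_prod_type,
    Matrix.one_apply, Finset.sum_mul]
  refine Finset.sum_congr rfl fun a _ => ?_
  rw [Finset.sum_eq_single x.1.2 (fun k _ hk => by simp [Ne.symm hk]) (by simp)]
  refine Finset.sum_congr rfl fun b _ => ?_
  rw [Finset.sum_eq_single x.2.1.2 (fun k _ hk => by simp [Ne.symm hk]) (by simp)]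
  simp [mul_assoc]

end Local

/-! ### Truncating both parties at once. -/

section Truncate

variable {A B R : Type*} [Fintype A] [Fintype B] [Fintype R] [DecidableEq A] [DecidableEq B]

/-- Change one party at a time: the second difference is only contracted by `P`, and `2η + 2η = 4η`.
-/
lemma normSq_sub_localAct_le {φ : A × B × R → ℂ} {P : Matrix A A ℂ} {Q : Matrix B B ℂ}
    {η β β' r r' : ℝ}
    (hP : IsTruncation P (fun a y => φ (a, y.1, y.2) : Matrix A (B × R) ℂ) η β r)
    (hQ : IsTruncation Q (fun b y => φ (y.1, b, y.2) : Matrix B (A × R) ℂ) η β' r') :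
    normSq (φ - localAct P Q φ) ≤ 4 * η := by
  have h1 : φ - localAct P Q φ = (φ - localAct P 1 φ) + localAct P 1 (φ - localAct 1 Q φ) := by
    rw [localAct_sub, localAct_localAct, Matrix.mul_one, Matrix.one_mul]
    abel
  have h2 : normSq (φ - localAct P 1 φ) ≤ η := by
    refine le_trans (le_of_eq ?_) hP.close
    simp only [normSq, Fintype.sum_prod_type]
    refine Finset.sum_congr rfl fun a _ => Finset.sum_congr rfl fun b _ =>
      Finset.sum_congr rfl fun r _ => ?_
    simp [localAct, Fintype.sum_prod_type, Matrix.one_apply]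
    rfl
  have h3 : normSq (φ - localAct 1 Q φ) ≤ η := by
    refine le_trans (le_of_eq ?_) hQ.close
    simp only [normSq, Fintype.sum_prod_type]
    rw [Finset.sum_comm]
    refine Finset.sum_congr rfl fun a _ => Finset.sum_congr rfl fun b _ =>
      Finset.sum_congr rfl fun r _ => ?_
    simp [localAct, Fintype.sum_prod_type, Matrix.one_apply]
    rfl
  have h4 := normSq_localAct_projection_le hP.hermitian hP.idempotent Matrix.conjTranspose_one
    (Matrix.one_mul (1 : Matrix B B ℂ)) (φ - localAct 1 Q φ)
  rw [h1]
  have := normSq_add_le (φ - localAct P 1 φ) (localAct P 1 (φ - localAct 1 Q φ))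
  linarith

/-- The bound of a truncation, on vectors in the range of the projection. -/
lemma IsTruncation.bound_of_fixed {X Y : Type*} [Fintype X] [Fintype Y] {P : Matrix X X ℂ}
    {M : Matrix X Y ℂ} {η β r : ℝ} (h : IsTruncation P M η β r) {z : X → ℂ}
    (hz : ∀ x, ∑ x', P x x' * z x' = z x) :
    ∑ y, ‖∑ x, star (M x y) * z x‖ ^ 2 ≤ β * ∑ x, ‖z x‖ ^ 2 := by
  refine le_trans (le_of_eq ?_) (h.bound z)
  refine Finset.sum_congr rfl fun y _ => ?_
  congr 2
  have h1 : ∀ x, star ((P * M) x y) * z x = ∑ x', star (M x' y) * (P x' x * z x) := by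
    intro x
    rw [Matrix.mul_apply, star_sum, Finset.sum_mul]
    refine Finset.sum_congr rfl fun x' _ => ?_
    have := congrFun (congrFun h.hermitian x') x
    rw [Matrix.conjTranspose_apply] at this
    rw [star_mul', this]
    ring
  simp_rw [h1]
  rw [Finset.sum_comm]
  refine Finset.sum_congr rfl fun x _ => ?_
  rw [← Finset.mul_sum, hz]

end Truncate

/-! ### Exchange and distillation -/

lemma sum_reorder {W J K Z : Type*} [Fintype W] [Fintype J] [Fintype K] [Fintype Z]
    (f : W → J → K → Z → ℝ) :
    ∑ w, ∑ z : J × K, ∑ z', f w z.1 z.2 z' = ∑ z', ∑ k, ∑ j, ∑ w, f w j k z' := by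
  simp only [Fintype.sum_prod_type]
  rw [sum_four_comm]
  refine Finset.sum_congr rfl fun z' _ => ?_
  have : ∀ j, ∑ w, ∑ k, f w j k z' = ∑ k, ∑ w, f w j k z' := fun j => Finset.sum_comm
  simp_rw [this]
  exact Finset.sum_comm

section Distill

variable {A B R E : Type*} [Fintype A] [Fintype B] [Fintype R] [Fintype E] [DecidableEq A]
  [DecidableEq B] [DecidableEq R] {ℓ : ℕ} {J : E → Type*} [∀ e, Fintype (J e)]
  {N : E → Matrix (Fin ℓ) R ℂ} {D : ∀ e, J e → Matrix (Fin ℓ) A ℂ}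

/-- Cauchy–Schwarz over all indices at once separates Alice's factors `F` from Bob's factors `G`. In
each, the decoder sums away by isometry, and the sum over leftover states is bounded by `β`. The
index is a sigma type because the decoder's outcomes depend on `e`. -/
lemma sq_norm_amplitude_distillPart_le {K L : ℕ} (hD : ∀ e, IsIsometric (D e))
    (X : Matrix (B × Fin L) (A × Fin K) ℂ) (Y : Matrix (A × Fin L) (B × Fin K) ℂ)
    (φ : A × B × R → ℂ) (β : ℝ)
    (hX : ∀ l p, ∑ e, ∑ j, ‖∑ b, star (distillRest N D φ e j b) * X (b, l) p‖ ^ 2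
      ≤ β * ∑ b, ‖X (b, l) p‖ ^ 2)
    (hY : ∀ p k, ∑ e, ∑ j, ‖∑ b, Y p (b, k) * distillRest N D φ e j b‖ ^ 2
      ≤ β * ∑ b, ‖Y p (b, k)‖ ^ 2) :
    ‖amplitude X Y (withEbits L (swapParties (distillPart N D φ)))
        (withEbits K (distillPart N D φ))‖ ^ 2
      ≤ (ℓ : ℝ)⁻¹ * (ℓ : ℝ)⁻¹ * ((K : ℝ)⁻¹ * (L : ℝ)⁻¹) *
        ((β * ∑ q, ∑ p, ‖X q p‖ ^ 2) * (β * ∑ q, ∑ p, ‖Y q p‖ ^ 2)) := by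
  set F : (Σ s : Fin ℓ × E, (J s.2 × Fin K) × (J s.2 × Fin L)) → ℂ := fun q =>
    ∑ b, (∑ a, X (b, q.2.2.2) (a, q.2.1.2) * star (D q.1.2 q.2.1.1 q.1.1 a))
      * star (distillRest N D φ q.1.2 q.2.2.1 b) with hF
  set G : (Σ s : Fin ℓ × E, (J s.2 × Fin K) × (J s.2 × Fin L)) → ℂ := fun q =>
    ∑ a, (∑ b, Y (a, q.2.2.2) (b, q.2.1.2) * distillRest N D φ q.1.2 q.2.1.1 b)
      * D q.1.2 q.2.2.1 q.1.1 a with hG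
  have h1 : amplitude X Y (withEbits L (swapParties (distillPart N D φ)))
        (withEbits K (distillPart N D φ))
      = (((Real.sqrt ℓ)⁻¹ : ℝ) : ℂ) * (((Real.sqrt ℓ)⁻¹ : ℝ) : ℂ) *
        ((((Real.sqrt K)⁻¹ : ℝ) : ℂ) * (((Real.sqrt L)⁻¹ : ℝ) : ℂ)) * ∑ q, F q * G q := by
    rw [amplitude_distillPart, Fintype.sum_sigma]
    congr 1
    refine Finset.sum_congr rfl fun s _ => ?_
    rw [Fintype.sum_prod_type (α₁ := J s.2 × Fin K)]
  have hFn : ∑ q, ‖F q‖ ^ 2 ≤ β * ∑ q, ∑ p, ‖X q p‖ ^ 2 := by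
    -- Summing over `j` and `w` gives the squared norm after the isometry `D e`, hence that of the
    -- vector before it.
    have e1 : ∀ e k (z' : J e × Fin L), ∑ j : J e, ∑ w : Fin ℓ, ‖F ⟨(w, e), (j, k), z'⟩‖ ^ 2
        = ∑ a, ‖∑ b, star (distillRest N D φ e z'.1 b) * X (b, z'.2) (a, k)‖ ^ 2 := by
      intro e k z'
      have e2 : ∀ (j : J e) (w : Fin ℓ), ‖F ⟨(w, e), (j, k), z'⟩‖ = ‖∑ a, D e j w a *
          star (∑ b, star (distillRest N D φ e z'.1 b) * X (b, z'.2) (a, k))‖ := by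
        intro j w
        rw [← norm_star, hF, star_sum]
        congr 1
        simp only [star_mul', star_sum, star_star, Finset.mul_sum, Finset.sum_mul]
        rw [Finset.sum_comm]
        exact Finset.sum_congr rfl fun a _ => Finset.sum_congr rfl fun b _ => by ring
      simp_rw [e2]
      rw [(hD e).sum_sq]
      simp only [norm_star]
    rw [Fintype.sum_sigma, Fintype.sum_prod_type, Finset.sum_comm]
    calc _ = ∑ e, ∑ z' : J e × Fin L, ∑ k, ∑ j : J e, ∑ w : Fin ℓ, ‖F ⟨(w, e), (j, k), z'⟩‖ ^ 2 := by
          refine Finset.sum_congr rfl fun e _ => ?_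
          rw [← sum_reorder]
          refine Finset.sum_congr rfl fun w _ => ?_
          rw [Fintype.sum_prod_type (α₁ := J e × Fin K)]
      _ = ∑ l, ∑ k, ∑ a, ∑ e, ∑ j,
          ‖∑ b, star (distillRest N D φ e j b) * X (b, l) (a, k)‖ ^ 2 := by
          simp_rw [e1, Fintype.sum_prod_type]
          calc _ = ∑ e, ∑ l, ∑ k, ∑ a, ∑ j,
                ‖∑ b, star (distillRest N D φ e j b) * X (b, l) (a, k)‖ ^ 2 := by
                refine Finset.sum_congr rfl fun e _ => ?_
                rw [Finset.sum_comm]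
                refine Finset.sum_congr rfl fun l _ => ?_
                rw [Finset.sum_comm]
                refine Finset.sum_congr rfl fun k _ => ?_
                rw [Finset.sum_comm]
            _ = _ := by
                rw [Finset.sum_comm]
                refine Finset.sum_congr rfl fun l _ => ?_
                rw [Finset.sum_comm]
                refine Finset.sum_congr rfl fun k _ => ?_
                rw [Finset.sum_comm]
      _ ≤ ∑ l, ∑ k, ∑ a, β * ∑ b, ‖X (b, l) (a, k)‖ ^ 2 :=
          Finset.sum_le_sum fun l _ => Finset.sum_le_sum fun k _ =>
            Finset.sum_le_sum fun a _ => hX l (a, k)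
      _ = _ := by
          simp_rw [← Finset.mul_sum]
          congr 1
          simp only [Fintype.sum_prod_type]
          exact (sum_four_comm fun (b : B) (l : Fin L) (a : A) (k : Fin K) =>
            ‖X (b, l) (a, k)‖ ^ 2).symm ▸ (by
              rw [Finset.sum_comm]
              refine Finset.sum_congr rfl fun k _ => Finset.sum_congr rfl fun l _ => ?_
              rw [Finset.sum_comm])
  have hGn : ∑ q, ‖G q‖ ^ 2 ≤ β * ∑ q, ∑ p, ‖Y q p‖ ^ 2 := by
    have e1 : ∀ e l (z : J e × Fin K), ∑ j : J e, ∑ w : Fin ℓ, ‖G ⟨(w, e), z, (j, l)⟩‖ ^ 2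
        = ∑ a, ‖∑ b, Y (a, l) (b, z.2) * distillRest N D φ e z.1 b‖ ^ 2 := by
      intro e l z
      rw [← (hD e).sum_sq]
      refine Finset.sum_congr rfl fun j _ => Finset.sum_congr rfl fun w _ => ?_
      congr 2
      exact Finset.sum_congr rfl fun a _ => mul_comm _ _
    rw [Fintype.sum_sigma, Fintype.sum_prod_type, Finset.sum_comm]
    calc _ = ∑ e, ∑ z : J e × Fin K, ∑ l, ∑ j : J e, ∑ w : Fin ℓ, ‖G ⟨(w, e), z, (j, l)⟩‖ ^ 2 := by
          refine Finset.sum_congr rfl fun e _ => ?_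
          rw [← sum_reorder]
          refine Finset.sum_congr rfl fun w _ => ?_
          rw [Fintype.sum_prod_type (α₁ := J e × Fin K), Finset.sum_comm]
      _ = ∑ k, ∑ l, ∑ a, ∑ e, ∑ j,
          ‖∑ b, Y (a, l) (b, k) * distillRest N D φ e j b‖ ^ 2 := by
          simp_rw [e1, Fintype.sum_prod_type]
          calc _ = ∑ e, ∑ k, ∑ l, ∑ a, ∑ j,
                ‖∑ b, Y (a, l) (b, k) * distillRest N D φ e j b‖ ^ 2 := by
                refine Finset.sum_congr rfl fun e _ => ?_
                rw [Finset.sum_comm]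
                refine Finset.sum_congr rfl fun k _ => ?_
                rw [Finset.sum_comm]
                refine Finset.sum_congr rfl fun l _ => ?_
                rw [Finset.sum_comm]
            _ = _ := by
                rw [Finset.sum_comm]
                refine Finset.sum_congr rfl fun k _ => ?_
                rw [Finset.sum_comm]
                refine Finset.sum_congr rfl fun l _ => ?_
                rw [Finset.sum_comm]
      _ ≤ ∑ k, ∑ l, ∑ a, β * ∑ b, ‖Y (a, l) (b, k)‖ ^ 2 :=
          Finset.sum_le_sum fun k _ => Finset.sum_le_sum fun l _ =>
            Finset.sum_le_sum fun a _ => hY (a, l) k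
      _ = _ := by
          simp_rw [← Finset.mul_sum]
          congr 1
          simp only [Fintype.sum_prod_type]
          exact (sum_four_comm fun (a : A) (l : Fin L) (b : B) (k : Fin K) =>
            ‖Y (a, l) (b, k)‖ ^ 2).symm
  rw [h1, norm_mul, mul_pow, norm_mul, norm_mul, norm_mul, mul_pow, mul_pow, mul_pow,
    sq_norm_inv_sqrt, sq_norm_inv_sqrt, sq_norm_inv_sqrt]
  refine mul_le_mul_of_nonneg_left ?_ (by positivity)
  refine (sq_norm_sum_mul_le F G).trans ?_
  exact mul_le_mul hFn hGn (Finset.sum_nonneg fun _ _ => sq_nonneg _)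
    ((Finset.sum_nonneg fun _ _ => sq_nonneg _).trans hFn)

end Distill

/-! ### One-shot bound from distillation. -/

section OneShot

variable {A B R E ι : Type*} [Fintype A] [Fintype B] [Fintype R] [Fintype E] [Fintype ι]
  [DecidableEq A] [DecidableEq B] [DecidableEq R] {ℓ : ℕ} {J : E → Type*} [∀ e, Fintype (J e)]
  {N : E → Matrix (Fin ℓ) R ℂ} {D : ∀ e, J e → Matrix (Fin ℓ) A ℂ}

lemma sum_sq_kronecker_one {X : Type*} [Fintype X] (P : Matrix X X ℂ) (K : ℕ) :
    ∑ x, ∑ y, ‖(P ⊗ₖ (1 : Matrix (Fin K) (Fin K) ℂ)) x y‖ ^ 2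
      = K * ∑ x, ∑ y, ‖P x y‖ ^ 2 := by
  have h1 : ∀ x y : X × Fin K, ‖(P ⊗ₖ (1 : Matrix (Fin K) (Fin K) ℂ)) x y‖ ^ 2
      = ‖P x.1 y.1‖ ^ 2 * if x.2 = y.2 then 1 else 0 := by
    intro x y
    rw [Matrix.kroneckerMap_apply, norm_mul, mul_pow, Matrix.one_apply]
    split_ifs <;> simp
  simp_rw [h1, Fintype.sum_prod_type]
  simp only [mul_ite, mul_one, mul_zero, Finset.sum_ite_eq, Finset.mem_univ, if_true,
    Finset.sum_const, Finset.card_univ, Fintype.card_fin, nsmul_eq_mul]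
  rw [← Finset.mul_sum]

lemma amplitude_localAct_localAct {A B A' B' S : Type*} [Fintype A] [Fintype B] [Fintype A']
    [Fintype B'] [Fintype S] {P' : Matrix A' A' ℂ} {Q' : Matrix B' B' ℂ}
    (hP' : P'.conjTranspose = P') (hQ' : Q'.conjTranspose = Q') (P : Matrix A A ℂ)
    (Q : Matrix B B ℂ) (X : Matrix A' A ℂ) (Y : Matrix B' B ℂ) (f : A' × B' × S → ℂ)
    (g : A × B × S → ℂ) :
    amplitude X Y (localAct P' Q' f) (localAct P Q g)
      = amplitude (P' * X * P) (Q' * Y * Q) f g := by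
  rw [amplitude_localAct_left, hP', hQ']
  unfold amplitude
  rw [localAct_localAct]

/-- Separable exchange of the two parties' systems, when `ℓ`-dimensional entanglement can be
distilled between the reference and the first party. -/
theorem sum_sq_exchange_distill_le {K L : ℕ} (hK : 0 < K) (hL : 0 < L) (hℓ : 0 < ℓ)
    {X : ι → Matrix (B × Fin L) (A × Fin K) ℂ} {Y : ι → Matrix (A × Fin L) (B × Fin K) ℂ}
    (h : IsIsometric fun i => X i ⊗ₖ Y i) {φ : A × B × R → ℂ} (hφ : normSq φ = 1)
    (hN : IsIsometric N) (hD : ∀ e, IsIsometric (D e)) {ε η β β' r r' : ℝ}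
    (hε : 1 - ε ≤ ∑ e, ∑ j, ∑ b, ‖distillRest N D φ e j b‖ ^ 2)
    {P : Matrix A A ℂ} {Q : Matrix B B ℂ}
    (hP : IsTruncation P (fun a y => φ (a, y.1, y.2) : Matrix A (B × R) ℂ) η β' r)
    (hQ : IsTruncation Q (fun b y => φ (y.1, b, y.2) : Matrix B (A × R) ℂ) η β r') :
    ∑ i, ‖amplitude (X i) (Y i) (withEbits L (swapParties φ)) (withEbits K φ)‖ ^ 2
      ≤ 9 * (K / L * ((ℓ : ℝ)⁻¹ ^ 2 * β ^ 2 * (r * r'))) + 18 * ε + 24 * η := by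
  have hK0 : (0 : ℝ) < K := by exact_mod_cast hK
  have hL0 : (0 : ℝ) < L := by exact_mod_cast hL
  set u := withEbits L (swapParties φ) with hu
  set v := withEbits K φ with hv
  set PK := P ⊗ₖ (1 : Matrix (Fin K) (Fin K) ℂ) with hPK
  set QK := Q ⊗ₖ (1 : Matrix (Fin K) (Fin K) ℂ) with hQK
  set PL := P ⊗ₖ (1 : Matrix (Fin L) (Fin L) ℂ) with hPL
  set QL := Q ⊗ₖ (1 : Matrix (Fin L) (Fin L) ℂ) with hQL
  have hPK1 : PK.conjTranspose = PK := by
    rw [hPK, Matrix.conjTranspose_kronecker, hP.hermitian, Matrix.conjTranspose_one]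
  have hQK1 : QK.conjTranspose = QK := by
    rw [hQK, Matrix.conjTranspose_kronecker, hQ.hermitian, Matrix.conjTranspose_one]
  have hPL1 : PL.conjTranspose = PL := by
    rw [hPL, Matrix.conjTranspose_kronecker, hP.hermitian, Matrix.conjTranspose_one]
  have hQL1 : QL.conjTranspose = QL := by
    rw [hQL, Matrix.conjTranspose_kronecker, hQ.hermitian, Matrix.conjTranspose_one]
  have hPK2 : PK * PK = PK := by
    rw [hPK, ← Matrix.mul_kronecker_mul, hP.idempotent, Matrix.mul_one]
  have hQK2 : QK * QK = QK := by
    rw [hQK, ← Matrix.mul_kronecker_mul, hQ.idempotent, Matrix.mul_one]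
  have hPL2 : PL * PL = PL := by
    rw [hPL, ← Matrix.mul_kronecker_mul, hP.idempotent, Matrix.mul_one]
  have hQL2 : QL * QL = QL := by
    rw [hQL, ← Matrix.mul_kronecker_mul, hQ.idempotent, Matrix.mul_one]
  have hun : normSq u = 1 := by rw [hu, normSq_withEbits hL, normSq_swapParties, hφ]
  have hvn : normSq v = 1 := by rw [hv, normSq_withEbits hK, hφ]
  -- The projections are absorbed into the protocol, not into the vectors, because `distillPart`
  -- need not lie in the typical subspaces.
  set X' : ι → Matrix (B × Fin L) (A × Fin K) ℂ := fun i => QL * X i * PK with hX'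
  set Y' : ι → Matrix (A × Fin L) (B × Fin K) ℂ := fun i => PL * Y i * QK with hY'
  have hφd : normSq (φ - localAct P Q φ) ≤ 4 * η := normSq_sub_localAct_le hP hQ
  have hvd : normSq (v - localAct PK QK v) ≤ 4 * η := by
    rw [hv, ← withEbits_localAct, ← withEbits_sub, normSq_withEbits hK]
    exact hφd
  have hud : normSq (u - localAct QL PL u) ≤ 4 * η := by
    rw [hu, ← withEbits_localAct, ← withEbits_sub, normSq_withEbits hL]
    refine le_trans (le_of_eq ?_) hφd
    rw [← normSq_swapParties (φ - localAct P Q φ)]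
    congr 1
    funext x
    simp only [Pi.sub_apply, swapParties, localAct, Fintype.sum_prod_type,
      Matrix.kroneckerMap_apply]
    rw [Finset.sum_comm]
    congr 1
    exact Finset.sum_congr rfl fun a _ => Finset.sum_congr rfl fun b _ => by ring
  have hu'n : normSq (localAct QL PL u) ≤ 1 := by
    rw [← hun]
    exact normSq_localAct_projection_le hQL1 hQL2 hPL1 hPL2 u
  have hη : 0 ≤ 4 * η := (normSq_nonneg _).trans hφd
  -- The truncated operators need not form an isometric family, but the inequality of
  -- `sum_sq_amplitude_le` survives: projections move onto the vectors and shrink them.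
  have hbes : ∀ (f : (B × Fin L) × (A × Fin L) × (Fin ℓ × E) → ℂ)
      (g : (A × Fin K) × (B × Fin K) × (Fin ℓ × E) → ℂ),
      ∑ i, ‖amplitude (X' i) (Y' i) f g‖ ^ 2 ≤ normSq f * normSq g := by
    intro f g
    simp only [hX', hY', ← amplitude_localAct_localAct hQL1 hPL1]
    refine (sum_sq_amplitude_le h _ _).trans ?_
    exact mul_le_mul (normSq_localAct_projection_le hQL1 hQL2 hPL1 hPL2 f)
      (normSq_localAct_projection_le hPK1 hPK2 hQK1 hQK2 g) (normSq_nonneg _) (normSq_nonneg _)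
  -- the truncated protocol on the distilled vectors
  set u₀ := withEbits L (swapParties (distillPart N D φ)) with hu₀
  set v₀ := withEbits K (distillPart N D φ) with hv₀
  have hfd : normSq (dilate N φ - distillPart N D φ) ≤ ε := by
    have := normSq_dilate_sub_distillPart_le hℓ hN hD φ
    rw [hφ] at this
    linarith
  have hfn : normSq (distillPart N D φ) ≤ 1 := by
    have h1 := normSq_dilate_sub_distillPart_le hℓ hN hD φ
    have h2 := sum_sq_distillPart_le (N := N) hℓ hD φ
    have h3 := normSq_nonneg (dilate N φ - distillPart N D φ)
    rw [hφ] at h1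
    linarith
  have hε0 : 0 ≤ ε := (normSq_nonneg _).trans hfd
  have hu₀n : normSq u₀ ≤ 1 := by
    rw [hu₀, normSq_withEbits hL, normSq_swapParties]
    exact hfn
  have hu₀d : normSq (dilate N u - u₀) ≤ ε := by
    rw [hu, dilate_withEbits, dilate_swapParties, hu₀, ← withEbits_sub, normSq_withEbits hL]
    refine le_trans (le_of_eq ?_) hfd
    exact normSq_swapParties (dilate N φ - distillPart N D φ)
  have hv₀d : normSq (dilate N v - v₀) ≤ ε := by
    rw [hv, dilate_withEbits, hv₀, ← withEbits_sub, normSq_withEbits hK]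
    exact hfd
  have hmain : ∑ i, ‖amplitude (X' i) (Y' i) u₀ v₀‖ ^ 2
      ≤ K / L * ((ℓ : ℝ)⁻¹ ^ 2 * β ^ 2 * (r * r')) := by
    -- The leftover states add up to at most Bob's marginal. It is at most `β` on the range of `Q`,
    -- where the columns of `X'` lie; the same applies below to the conjugated rows of `Y'`.
    have hX1 : ∀ i l p, ∑ e, ∑ j, ‖∑ b, star (distillRest N D φ e j b) * X' i (b, l) p‖ ^ 2
        ≤ β * ∑ b, ‖X' i (b, l) p‖ ^ 2 := by
      intro i l p
      refine (sum_sq_distillRest_le hℓ hN hD φ _).trans ?_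
      refine hQ.bound_of_fixed (z := fun b => X' i (b, l) p) fun b => ?_
      have h1 : QL * X' i = X' i := by
        rw [hX']
        simp only [← Matrix.mul_assoc, hQL2]
      conv_rhs => rw [← h1, Matrix.mul_apply, Fintype.sum_prod_type]
      simp [hQL, Matrix.kroneckerMap_apply, Matrix.one_apply]
    have hY1 : ∀ i p k, ∑ e, ∑ j, ‖∑ b, Y' i p (b, k) * distillRest N D φ e j b‖ ^ 2
        ≤ β * ∑ b, ‖Y' i p (b, k)‖ ^ 2 := by
      intro i p k
      have h0 := (sum_sq_distillRest_le hℓ hN hD φ fun b => star (Y' i p (b, k))).trans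
        (hQ.bound_of_fixed (z := fun b => star (Y' i p (b, k))) fun b => ?_)
      · simp only [norm_star] at h0
        refine le_trans (le_of_eq ?_) h0
        refine Finset.sum_congr rfl fun e _ => Finset.sum_congr rfl fun j _ => ?_
        rw [← norm_star, star_sum]
        simp only [star_mul']
        congr 2
        exact Finset.sum_congr rfl fun b _ => mul_comm _ _
      · have h1 : Y' i * QK = Y' i := by
          rw [hY']
          simp only [Matrix.mul_assoc, hQK2]
        conv_rhs => rw [← h1, Matrix.mul_apply, Fintype.sum_prod_type]
        have h2 : ∀ b', Q b b' = star (Q b' b) := fun b' => by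
          rw [← Matrix.conjTranspose_apply, hQ.hermitian]
        simp [hQK, Matrix.kroneckerMap_apply, Matrix.one_apply, h2, mul_comm]
    have hXn : ∀ i, ∑ q, ∑ p, ‖X' i q p‖ ^ 2 ≤ ∑ q, ∑ p, ‖∑ a, X i q a * PK a p‖ ^ 2 := by
      intro i
      have e : X' i = QL * (X i * PK) := Matrix.mul_assoc _ _ _
      rw [e]
      exact sum_sq_projection_mul_le hQL1 hQL2 (X i * PK)
    have hYn : ∀ i, ∑ q, ∑ p, ‖Y' i q p‖ ^ 2 ≤ ∑ q, ∑ p, ‖∑ b, Y i q b * QK b p‖ ^ 2 := by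
      intro i
      have e : Y' i = PL * (Y i * QK) := Matrix.mul_assoc _ _ _
      rw [e]
      exact sum_sq_projection_mul_le hPL1 hPL2 (Y i * QK)
    have hXY : ∑ i, (∑ q, ∑ p, ‖X' i q p‖ ^ 2) * (∑ q, ∑ p, ‖Y' i q p‖ ^ 2)
        ≤ (K * r) * (K * r') := by
      calc _ ≤ ∑ i, (∑ q, ∑ p, ‖∑ a, X i q a * PK a p‖ ^ 2) *
            (∑ q, ∑ p, ‖∑ b, Y i q b * QK b p‖ ^ 2) :=
            Finset.sum_le_sum fun i _ => mul_le_mul (hXn i) (hYn i)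
              (Finset.sum_nonneg fun _ _ => Finset.sum_nonneg fun _ _ => sq_nonneg _)
              (Finset.sum_nonneg fun _ _ => Finset.sum_nonneg fun _ _ => sq_nonneg _)
        _ = (∑ a, ∑ s, ‖PK a s‖ ^ 2) * ∑ b, ∑ t, ‖QK b t‖ ^ 2 := sum_frobenius_mul h PK QK
        _ ≤ (K * r) * (K * r') := by
            rw [hPK, hQK, sum_sq_kronecker_one, sum_sq_kronecker_one]
            have h1 := mul_le_mul_of_nonneg_left hP.trace_le hK0.le
            refine mul_le_mul h1 (mul_le_mul_of_nonneg_left hQ.trace_le hK0.le) ?_ (le_trans ?_ h1)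
            all_goals
              refine mul_nonneg hK0.le ?_
              exact Finset.sum_nonneg fun _ _ => Finset.sum_nonneg fun _ _ => sq_nonneg _
    calc _ ≤ ∑ i, (ℓ : ℝ)⁻¹ * (ℓ : ℝ)⁻¹ * ((K : ℝ)⁻¹ * (L : ℝ)⁻¹) *
          ((β * ∑ q, ∑ p, ‖X' i q p‖ ^ 2) * (β * ∑ q, ∑ p, ‖Y' i q p‖ ^ 2)) :=
          Finset.sum_le_sum fun i _ =>
            sq_norm_amplitude_distillPart_le hD _ _ φ β (hX1 i) (hY1 i)
      _ = (ℓ : ℝ)⁻¹ * (ℓ : ℝ)⁻¹ * ((K : ℝ)⁻¹ * (L : ℝ)⁻¹) * β ^ 2 *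
          ∑ i, (∑ q, ∑ p, ‖X' i q p‖ ^ 2) * (∑ q, ∑ p, ‖Y' i q p‖ ^ 2) := by
          rw [Finset.mul_sum]
          exact Finset.sum_congr rfl fun i _ => by ring
      _ ≤ (ℓ : ℝ)⁻¹ * (ℓ : ℝ)⁻¹ * ((K : ℝ)⁻¹ * (L : ℝ)⁻¹) * β ^ 2 * ((K * r) * (K * r')) :=
          mul_le_mul_of_nonneg_left hXY (by positivity)
      _ = K / L * ((ℓ : ℝ)⁻¹ ^ 2 * β ^ 2 * (r * r')) := by
          field_simp
  have htrunc : ∑ i, ‖amplitude (X' i) (Y' i) u v‖ ^ 2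
      ≤ 3 * (K / L * ((ℓ : ℝ)⁻¹ ^ 2 * β ^ 2 * (r * r'))) + 6 * ε := by
    have h1 : ∀ i, amplitude (X' i) (Y' i) u v
        = amplitude (X' i) (Y' i) (dilate N u) (dilate N v) :=
      fun i => (amplitude_dilate hN _ _ _ _).symm
    have h2 := hbes u₀ (dilate N v - v₀)
    have h3 := hbes (dilate N u - u₀) (dilate N v)
    rw [normSq_dilate hN, hvn, mul_one] at h3
    have h4 : normSq u₀ * normSq (dilate N v - v₀) ≤ 1 * ε :=
      mul_le_mul hu₀n hv₀d (normSq_nonneg _) zero_le_one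
    simp_rw [h1]
    refine (Finset.sum_le_sum fun i _ => sq_norm_amplitude_le _ _ _ u₀ _ v₀).trans ?_
    simp only [Finset.sum_add_distrib, ← Finset.mul_sum]
    linarith
  -- The outer replacement triples the truncated bound, including its `6ε`, and adds two errors `3 *
  -- 4η`: in total `18ε + 24η`.
  have h2 := sum_sq_amplitude_le h (localAct QL PL u) (v - localAct PK QK v)
  have h3 := sum_sq_amplitude_le h (u - localAct QL PL u) v
  rw [hvn, mul_one] at h3
  have h4 : normSq (localAct QL PL u) * normSq (v - localAct PK QK v) ≤ 1 * (4 * η) :=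
    mul_le_mul hu'n hvd (normSq_nonneg _) zero_le_one
  simp only [hX', hY', ← amplitude_localAct_localAct hQL1 hPL1] at htrunc
  refine (Finset.sum_le_sum fun i _ => sq_norm_amplitude_le _ _ _ (localAct QL PL u) _
    (localAct PK QK v)).trans ?_
  simp only [Finset.sum_add_distrib, ← Finset.mul_sum]
  linarith

end OneShot

/-! ### Typical sequences -/

section Typical

variable {X : Type*} [Fintype X]

lemma sum_fin_succ {M : Type*} [AddCommMonoid M] {n : ℕ} (f : (Fin (n + 1) → X) → M) :
    ∑ t, f t = ∑ x, ∑ t : Fin n → X, f (Fin.cons x t) := by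
  rw [← Fintype.sum_prod_type']
  exact (Equiv.sum_comp (Fin.consEquiv fun _ => X) f).symm

lemma sum_prod_eq_one {p : X → ℝ} (hp : ∑ x, p x = 1) (n : ℕ) :
    ∑ t : Fin n → X, ∏ i, p (t i) = 1 := by
  induction n with
  | zero => simp
  | succ n ih =>
    rw [sum_fin_succ]
    simp only [Fin.prod_univ_succ, Fin.cons_zero, Fin.cons_succ, ← Finset.mul_sum, ih, mul_one, hp]

lemma sum_prod_mul_sum {p g : X → ℝ} (hp : ∑ x, p x = 1) (hg : ∑ x, p x * g x = 0) (n : ℕ) :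
    ∑ t : Fin n → X, (∏ i, p (t i)) * ∑ i, g (t i) = 0 := by
  induction n with
  | zero => simp
  | succ n ih =>
    rw [sum_fin_succ]
    simp only [Fin.prod_univ_succ, Fin.sum_univ_succ, Fin.cons_zero, Fin.cons_succ]
    have h1 : ∀ x, ∑ t : Fin n → X, (p x * ∏ i, p (t i)) * (g x + ∑ i, g (t i))
        = p x * g x := by
      intro x
      have h2 : ∀ t : Fin n → X, (p x * ∏ i, p (t i)) * (g x + ∑ i, g (t i))
          = p x * g x * (∏ i, p (t i)) + p x * ((∏ i, p (t i)) * ∑ i, g (t i)) := fun t => by ring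
      simp_rw [h2, Finset.sum_add_distrib, ← Finset.mul_sum, ih, sum_prod_eq_one hp]
      ring
    simp_rw [h1, hg]

/-- The variance of a sum of independent, identically distributed variables. -/
lemma sum_prod_mul_sq_sum {p g : X → ℝ} (hp : ∑ x, p x = 1) (hg : ∑ x, p x * g x = 0) (n : ℕ) :
    ∑ t : Fin n → X, (∏ i, p (t i)) * (∑ i, g (t i)) ^ 2 = n * ∑ x, p x * g x ^ 2 := by
  induction n with
  | zero => simp
  | succ n ih =>
    rw [sum_fin_succ]
    simp only [Fin.prod_univ_succ, Fin.sum_univ_succ, Fin.cons_zero, Fin.cons_succ]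
    have h1 : ∀ x, ∑ t : Fin n → X, (p x * ∏ i, p (t i)) * (g x + ∑ i, g (t i)) ^ 2
        = p x * g x ^ 2 + p x * (n * ∑ x, p x * g x ^ 2) := by
      intro x
      have h2 : ∀ t : Fin n → X, (p x * ∏ i, p (t i)) * (g x + ∑ i, g (t i)) ^ 2
          = p x * g x ^ 2 * (∏ i, p (t i)) + 2 * p x * g x * ((∏ i, p (t i)) * ∑ i, g (t i))
            + p x * ((∏ i, p (t i)) * (∑ i, g (t i)) ^ 2) := fun t => by ring
      simp_rw [h2, Finset.sum_add_distrib, ← Finset.mul_sum, ih, sum_prod_eq_one hp,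
        sum_prod_mul_sum hp hg]
      ring
    simp_rw [h1, Finset.sum_add_distrib, ← Finset.sum_mul, hp]
    push_cast
    ring

/-- The Shannon entropy, to base two. -/
def shannon (p : X → ℝ) : ℝ := (∑ x, Real.negMulLog (p x)) / Real.log 2

lemma shannon_eq (p : X → ℝ) : shannon p = ∑ x, p x * -Real.logb 2 (p x) := by
  rw [shannon, Finset.sum_div]
  refine Finset.sum_congr rfl fun x _ => ?_
  rw [Real.negMulLog, Real.logb]
  ring

open Classical in
/-- The sequences of positive probability whose logarithmic probability deviates by at most `n * δ`
from its mean. -/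
def typicalSet (p : X → ℝ) (δ : ℝ) (n : ℕ) : Finset (Fin n → X) :=
  {t | (∀ i, 0 < p (t i)) ∧ |∑ i, -Real.logb 2 (p (t i)) - n * shannon p| ≤ n * δ}

/-- Positivity is essential, since `Real.logb 2 0 = 0` would assign weight `1` to a letter of
probability zero. -/
lemma prod_eq_rpow {p : X → ℝ} {n : ℕ} {t : Fin n → X} (h : ∀ i, 0 < p (t i)) :
    ∏ i, p (t i) = (2 : ℝ) ^ (-∑ i, -Real.logb 2 (p (t i))) := by
  rw [Finset.sum_neg_distrib, neg_neg, Real.rpow_sum_of_pos two_pos]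
  exact Finset.prod_congr rfl fun i _ => (Real.rpow_logb two_pos (by norm_num) (h i)).symm

lemma prod_le_of_mem_typicalSet {p : X → ℝ} {δ : ℝ} {n : ℕ} {t : Fin n → X}
    (h : t ∈ typicalSet p δ n) : ∏ i, p (t i) ≤ (2 : ℝ) ^ (-(n * (shannon p - δ))) := by
  simp only [typicalSet, Finset.mem_filter, Finset.mem_univ, true_and] at h
  rw [prod_eq_rpow h.1]
  refine Real.rpow_le_rpow_of_exponent_le one_le_two ?_
  have := (abs_le.1 h.2).1
  linarith

lemma le_prod_of_mem_typicalSet {p : X → ℝ} {δ : ℝ} {n : ℕ} {t : Fin n → X}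
    (h : t ∈ typicalSet p δ n) : (2 : ℝ) ^ (-(n * (shannon p + δ))) ≤ ∏ i, p (t i) := by
  simp only [typicalSet, Finset.mem_filter, Finset.mem_univ, true_and] at h
  rw [prod_eq_rpow h.1]
  refine Real.rpow_le_rpow_of_exponent_le one_le_two ?_
  have := (abs_le.1 h.2).2
  linarith

lemma card_typicalSet_le {p : X → ℝ} (hp0 : ∀ x, 0 ≤ p x) (hp : ∑ x, p x = 1) (δ : ℝ) (n : ℕ) :
    ((typicalSet p δ n).card : ℝ) ≤ (2 : ℝ) ^ (n * (shannon p + δ)) := by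
  have h1 : ((typicalSet p δ n).card : ℝ) * (2 : ℝ) ^ (-(n * (shannon p + δ))) ≤ 1 := by
    rw [← sum_prod_eq_one hp n, ← nsmul_eq_mul]
    refine (Finset.card_nsmul_le_sum (typicalSet p δ n) (fun t => ∏ i, p (t i)) _
      fun t ht => le_prod_of_mem_typicalSet ht).trans ?_
    exact Finset.sum_le_sum_of_subset_of_nonneg (Finset.subset_univ _)
      fun t _ _ => Finset.prod_nonneg fun i _ => hp0 _
  rwa [Real.rpow_neg two_pos.le, ← div_eq_mul_inv, div_le_one (by positivity)] at h1

/-- Chebyshev's inequality for the centred log-probabilities `g`: the sum over `n` letters has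
variance `n V`, so the atypical weight is at most `V / (n δ²)`. -/
lemma exists_sum_compl_typicalSet_le [DecidableEq X] {p : X → ℝ} (hp0 : ∀ x, 0 ≤ p x) (hp : ∑ x, p x = 1)
    {δ η : ℝ} (hδ : 0 < δ) (hη : 0 < η) :
    ∃ N : ℕ, ∀ n, N ≤ n → ∑ t ∈ (typicalSet p δ n)ᶜ, ∏ i, p (t i) ≤ η := by
  set g : X → ℝ := fun x => -Real.logb 2 (p x) - shannon p with hg
  have hg0 : ∑ x, p x * g x = 0 := by
    simp only [hg, mul_sub, Finset.sum_sub_distrib, ← Finset.sum_mul, hp, one_mul]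
    rw [← shannon_eq, sub_self]
  set V := ∑ x, p x * g x ^ 2 with hV
  obtain ⟨N, hN⟩ := exists_nat_ge (V / (δ ^ 2 * η))
  refine ⟨N + 1, fun n hn => ?_⟩
  have hn0 : (0 : ℝ) < n := by exact_mod_cast (Nat.succ_pos N).trans_le hn
  have hnN : V / (δ ^ 2 * η) ≤ n := hN.trans (by exact_mod_cast (Nat.le_succ N).trans hn)
  have h1 : ∀ t ∈ (typicalSet p δ n)ᶜ,
      (n * δ) ^ 2 * ∏ i, p (t i) ≤ (∏ i, p (t i)) * (∑ i, g (t i)) ^ 2 := by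
    intro t ht
    by_cases h0 : ∀ i, 0 < p (t i)
    · rw [mul_comm]
      refine mul_le_mul_of_nonneg_left ?_ (Finset.prod_nonneg fun i _ => hp0 _)
      simp only [typicalSet, Finset.mem_compl, Finset.mem_filter, Finset.mem_univ, true_and,
        not_and, not_le] at ht
      have h2 := ht h0
      have h3 : ∑ i, g (t i) = ∑ i, -Real.logb 2 (p (t i)) - n * shannon p := by
        simp [hg, Finset.sum_sub_distrib]
      rw [h3, ← sq_abs (_ - _)]
      exact pow_le_pow_left₀ (by positivity) h2.le 2
    -- A sequence containing a letter of probability zero is atypical by definition, but has no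
    -- weight.
    · push Not at h0
      obtain ⟨i, hi⟩ := h0
      rw [Finset.prod_eq_zero (Finset.mem_univ i) (le_antisymm hi (hp0 _))]
      simp
  have h2 : (n * δ) ^ 2 * ∑ t ∈ (typicalSet p δ n)ᶜ, ∏ i, p (t i) ≤ n * V := by
    rw [Finset.mul_sum, ← sum_prod_mul_sq_sum hp hg0 n]
    refine (Finset.sum_le_sum h1).trans ?_
    exact Finset.sum_le_sum_of_subset_of_nonneg (Finset.subset_univ _)
      fun t _ _ => mul_nonneg (Finset.prod_nonneg fun i _ => hp0 _) (sq_nonneg _)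
  rw [div_le_iff₀ (by positivity)] at hnN
  refine le_of_mul_le_mul_left (h2.trans ?_) (by positivity : 0 < (n * δ) ^ 2)
  calc n * V ≤ n * (n * (δ ^ 2 * η)) := mul_le_mul_of_nonneg_left hnN hn0.le
    _ = (n * δ) ^ 2 * η := by ring

end Typical

/-! ### Typical projections -/

section TypicalProjection

variable {X Y Z X' Y' : Type*} [Fintype X] [Fintype Y] [Fintype Z] [Fintype X'] [Fintype Y']

lemma IsTruncation.submatrix {P : Matrix X X ℂ} {M : Matrix X Y ℂ} {η β r : ℝ}
    (h : IsTruncation P M η β r) (e : X' ≃ X) (f : Y' ≃ Y) :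
    IsTruncation (P.submatrix e e) (M.submatrix e f) η β r where
  hermitian := by rw [Matrix.conjTranspose_submatrix, h.hermitian]
  idempotent := by rw [Matrix.submatrix_mul_equiv, h.idempotent]
  close := by
    rw [Matrix.submatrix_mul_equiv]
    refine le_trans (le_of_eq ?_) h.close
    rw [← Equiv.sum_comp e]
    refine Finset.sum_congr rfl fun x _ => ?_
    rw [← Equiv.sum_comp f]
    rfl
  bound z := by
    rw [Matrix.submatrix_mul_equiv]
    have h1 := h.bound (z ∘ e.symm)
    rw [← Equiv.sum_comp f, ← Equiv.sum_comp e fun x => ‖(z ∘ e.symm) x‖ ^ 2] at h1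
    simp only [Function.comp_apply, Equiv.symm_apply_apply] at h1
    refine le_trans (le_of_eq ?_) h1
    refine Finset.sum_congr rfl fun y _ => ?_
    rw [← Equiv.sum_comp e]
    simp
  trace_le := by
    refine le_trans (le_of_eq ?_) h.trace_le
    rw [← Equiv.sum_comp e]
    refine Finset.sum_congr rfl fun x _ => ?_
    rw [← Equiv.sum_comp e]
    rfl

lemma sum_sq_eq_trace (M : Matrix X Y ℂ) :
    ((∑ x, ∑ y, ‖M x y‖ ^ 2 : ℝ) : ℂ) = (M * M.conjTranspose).trace := by
  push_cast
  simp only [Matrix.trace, Matrix.diag, Matrix.mul_apply, Matrix.conjTranspose_apply,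
    Complex.star_def, Complex.mul_conj']

lemma sum_sq_conjTranspose_mulVec (M : Matrix X Y ℂ) (z : X → ℂ) :
    ((∑ y, ‖∑ x, star (M x y) * z x‖ ^ 2 : ℝ) : ℂ)
      = star z ⬝ᵥ (M * M.conjTranspose).mulVec z := by
  rw [← Matrix.mulVec_mulVec, Matrix.dotProduct_mulVec, ← Matrix.conjTranspose_conjTranspose M,
    ← Matrix.star_mulVec, Matrix.conjTranspose_conjTranspose]
  push_cast
  simp only [dotProduct, Matrix.mulVec, Pi.star_apply, Complex.star_def, Complex.conj_mul',
    Matrix.conjTranspose_apply]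

/-- The spectral projection of `(U C) (U C)ᴴ` for a set `T` of the indices of its eigenvalues. -/
lemma isTruncation_of_diagonal [DecidableEq Z] {U : Matrix Z Z ℂ} (hU : U.conjTranspose * U = 1)
    {C : Matrix Z Y ℂ} {p : Z → ℝ} (hC : C * C.conjTranspose = Matrix.diagonal fun z => (p z : ℂ))
    (T : Finset Z) {η β r : ℝ} (hη : ∑ z ∈ Tᶜ, p z ≤ η) (hβ : ∀ z ∈ T, p z ≤ β) (hβ0 : 0 ≤ β)
    (hr : (T.card : ℝ) ≤ r) :
    IsTruncation (U * Matrix.diagonal (fun z => if z ∈ T then (1 : ℂ) else 0) * U.conjTranspose)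
      (U * C) η β r := by
  set Δ : Matrix Z Z ℂ := Matrix.diagonal (fun z => if z ∈ T then (1 : ℂ) else 0) with hΔ
  have hΔ1 : Δ.conjTranspose = Δ := by
    rw [hΔ, Matrix.diagonal_conjTranspose]
    congr 1
    funext z
    simp only [Pi.star_apply]
    split_ifs <;> simp
  have hΔ2 : Δ * Δ = Δ := by
    rw [hΔ, Matrix.diagonal_mul_diagonal]
    congr 1
    funext z
    split_ifs <;> simp
  have hP1 : (U * Δ * U.conjTranspose).conjTranspose = U * Δ * U.conjTranspose := by
    simp only [Matrix.conjTranspose_mul, Matrix.conjTranspose_conjTranspose, hΔ1, Matrix.mul_assoc]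
  have hP2 : U * Δ * U.conjTranspose * (U * Δ * U.conjTranspose) = U * Δ * U.conjTranspose := by
    calc _ = U * Δ * (U.conjTranspose * U) * Δ * U.conjTranspose := by
          simp only [Matrix.mul_assoc]
      _ = U * (Δ * Δ) * U.conjTranspose := by rw [hU, Matrix.mul_one]; simp only [Matrix.mul_assoc]
      _ = _ := by rw [hΔ2]
  have hPM : U * Δ * U.conjTranspose * (U * C) = U * (Δ * C) := by
    calc _ = U * Δ * (U.conjTranspose * U) * C := by simp only [Matrix.mul_assoc]
      _ = _ := by rw [hU, Matrix.mul_one, Matrix.mul_assoc]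
  refine ⟨hP1, hP2, ?_, ?_, ?_⟩
  · rw [hPM]
    have h1 : ((∑ x, ∑ y, ‖(U * C) x y - (U * (Δ * C)) x y‖ ^ 2 : ℝ) : ℂ)
        = ((∑ z ∈ Tᶜ, p z : ℝ) : ℂ) := by
      have h2 : U * C - U * (Δ * C) = U * ((1 - Δ) * C) := by
        rw [Matrix.sub_mul, Matrix.mul_sub, Matrix.one_mul]
      have h3 := sum_sq_eq_trace (U * C - U * (Δ * C))
      rw [h2, Matrix.conjTranspose_mul, Matrix.trace_mul_comm, Matrix.mul_assoc,
        ← Matrix.mul_assoc _ U, hU, Matrix.one_mul, Matrix.conjTranspose_mul,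
        Matrix.conjTranspose_sub, hΔ1, Matrix.conjTranspose_one, Matrix.trace_mul_comm,
        Matrix.mul_assoc, ← Matrix.mul_assoc C, hC, ← h2] at h3
      simp only [Matrix.sub_apply] at h3
      rw [h3]
      rw [hΔ, ← Matrix.diagonal_one, Matrix.diagonal_sub, Matrix.diagonal_mul_diagonal,
        Matrix.diagonal_mul_diagonal, Matrix.trace_diagonal, Complex.ofReal_sum,
        ← Finset.sum_filter_add_sum_filter_not Finset.univ (· ∈ T)]
      rw [Finset.sum_eq_zero (fun z hz => by simp [(Finset.mem_filter.1 hz).2]), zero_add]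
      refine Finset.sum_congr (by ext; simp) fun z hz => ?_
      simp [Finset.mem_compl.1 hz]
    rw [Complex.ofReal_inj.1 h1]
    exact hη
  · intro z
    rw [hPM]
    set w := U.conjTranspose.mulVec z with hw
    have hUU : U * U.conjTranspose = 1 := mul_eq_one_comm.1 hU
    have hwz : ((∑ x, ‖w x‖ ^ 2 : ℝ) : ℂ) = ((∑ x, ‖z x‖ ^ 2 : ℝ) : ℂ) := by
      have h2 := ofReal_normSq w
      have h3 := ofReal_normSq z
      simp only [normSq] at h2 h3
      rw [h2, h3]
      change star w ⬝ᵥ w = star z ⬝ᵥ z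
      rw [hw, Matrix.star_mulVec, Matrix.conjTranspose_conjTranspose, ← Matrix.dotProduct_mulVec,
        Matrix.mulVec_mulVec, hUU, Matrix.one_mulVec]
    have h1 : ((∑ y, ‖∑ x, star ((U * (Δ * C)) x y) * z x‖ ^ 2 : ℝ) : ℂ)
        = ((∑ x ∈ T, p x * ‖w x‖ ^ 2 : ℝ) : ℂ) := by
      rw [sum_sq_conjTranspose_mulVec]
      have h2 : U * (Δ * C) * (U * (Δ * C)).conjTranspose
          = U * (Δ * (Matrix.diagonal fun z => (p z : ℂ)) * Δ) * U.conjTranspose := by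
        rw [← hC]
        simp only [Matrix.conjTranspose_mul, hΔ1, Matrix.mul_assoc]
      rw [h2, ← Matrix.mulVec_mulVec, ← Matrix.mulVec_mulVec, Matrix.dotProduct_mulVec,
        ← Matrix.conjTranspose_conjTranspose U, ← Matrix.star_mulVec,
        Matrix.conjTranspose_conjTranspose, ← hw, hΔ, Matrix.diagonal_mul_diagonal,
        Matrix.diagonal_mul_diagonal]
      simp only [dotProduct, Matrix.mulVec_diagonal, Pi.star_apply]
      rw [Complex.ofReal_sum, ← Finset.sum_filter_add_sum_filter_not Finset.univ (· ∈ T),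
        add_eq_left.2 (Finset.sum_eq_zero fun x hx => by simp [(Finset.mem_filter.1 hx).2])]
      refine Finset.sum_congr (by ext; simp) fun x hx => ?_
      rw [if_pos hx, Complex.ofReal_mul, Complex.ofReal_pow, ← Complex.conj_mul', Complex.star_def]
      ring
    rw [Complex.ofReal_inj.1 h1, ← Complex.ofReal_inj.1 hwz, Finset.mul_sum]
    refine (Finset.sum_le_sum fun x hx => mul_le_mul_of_nonneg_right (hβ x hx)
      (sq_nonneg _)).trans ?_
    exact Finset.sum_le_sum_of_subset_of_nonneg (Finset.subset_univ _)
      fun x _ _ => mul_nonneg hβ0 (sq_nonneg _)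
  · refine le_trans (le_of_eq ?_) hr
    apply Complex.ofReal_inj.1
    rw [sum_sq_eq_trace, hP1, hP2, Matrix.mul_assoc, Matrix.trace_mul_comm, Matrix.mul_assoc, hU,
      Matrix.mul_one, hΔ, Matrix.trace_diagonal]
    simp

/-- `M^{⊗n}` -/
def tensorPower (M : Matrix X Y ℂ) (n : ℕ) : Matrix (Fin n → X) (Fin n → Y) ℂ :=
  fun s t => ∏ i, M (s i) (t i)

lemma tensorPower_mul (M : Matrix X Y ℂ) (M' : Matrix Y Z ℂ) (n : ℕ) :
    tensorPower (M * M') n = tensorPower M n * tensorPower M' n := by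
  ext s t
  simp only [tensorPower, Matrix.mul_apply, Finset.prod_univ_sum, Fintype.piFinset_univ,
    Finset.prod_mul_distrib]

lemma conjTranspose_tensorPower (M : Matrix X Y ℂ) (n : ℕ) :
    (tensorPower M n).conjTranspose = tensorPower M.conjTranspose n := by
  ext s t
  simp [tensorPower]

lemma tensorPower_diagonal [DecidableEq X] (d : X → ℂ) (n : ℕ) :
    tensorPower (Matrix.diagonal d) n = Matrix.diagonal fun t => ∏ i, d (t i) := by
  ext s t
  rw [tensorPower, Matrix.diagonal_apply]
  split_ifs with h
  · subst h
    simp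
  · obtain ⟨i, hi⟩ := Function.ne_iff.1 h
    exact Finset.prod_eq_zero (Finset.mem_univ i) (Matrix.diagonal_apply_ne _ hi)

lemma tensorPower_one [DecidableEq X] (n : ℕ) : tensorPower (1 : Matrix X X ℂ) n = 1 := by
  rw [← Matrix.diagonal_one, tensorPower_diagonal, ← Matrix.diagonal_one]
  simp

end TypicalProjection

lemma entropy_eq_shannon {X : Type} [Fintype X] [DecidableEq X] {ρ : Matrix X X ℂ}
    (hρ : ρ.IsHermitian) : entropy ρ = shannon hρ.eigenvalues := by
  rw [entropy, shannon, hρ.cfc_eq, Matrix.IsHermitian.cfc, Unitary.conjStarAlgAut_apply,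
    Matrix.trace_mul_comm, ← mul_assoc, Unitary.coe_star_mul_self, one_mul, Matrix.trace_diagonal]
  simp

/-- Diagonalize `M Mᴴ = U diag(p) Uᴴ`. Then `M^{⊗n} = U^{⊗n} (Uᴴ M)^{⊗n}`, where the second factor
has a diagonal Gram matrix with the product probabilities of `p` as entries; take the spectral
projection of the typical sequences. -/
theorem exists_isTruncation_tensorPower {X Y : Type} [Fintype X] [Fintype Y] [DecidableEq X]
    {M : Matrix X Y ℂ} (hM : ∑ x, ∑ y, ‖M x y‖ ^ 2 = 1) {δ η : ℝ} (hδ : 0 < δ) (hη : 0 < η) :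
    ∃ N : ℕ, ∀ n, N ≤ n → ∃ P, IsTruncation P (tensorPower M n) η
      ((2 : ℝ) ^ (-(n * (entropy (M * M.conjTranspose) - δ))))
      ((2 : ℝ) ^ (n * (entropy (M * M.conjTranspose) + δ))) := by
  have hρ : (M * M.conjTranspose).IsHermitian := Matrix.isHermitian_mul_conjTranspose_self M
  set p := hρ.eigenvalues with hp
  set U : Matrix X X ℂ := (hρ.eigenvectorUnitary : Matrix X X ℂ) with hU
  have hUU : U.conjTranspose * U = 1 := Unitary.coe_star_mul_self hρ.eigenvectorUnitary
  have hUU' : U * U.conjTranspose = 1 := mul_eq_one_comm.1 hUU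
  have hspec : M * M.conjTranspose = U * Matrix.diagonal (fun x => (p x : ℂ)) * U.conjTranspose := by
    have := hρ.spectral_theorem
    rw [Unitary.conjStarAlgAut_apply] at this
    exact this
  have hC : U.conjTranspose * M * (U.conjTranspose * M).conjTranspose
      = Matrix.diagonal fun x => (p x : ℂ) := by
    calc _ = U.conjTranspose * (M * M.conjTranspose) * U := by
          simp only [Matrix.conjTranspose_mul, Matrix.conjTranspose_conjTranspose, Matrix.mul_assoc]
      _ = (U.conjTranspose * U) * Matrix.diagonal (fun x => (p x : ℂ)) * (U.conjTranspose * U) := by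
          rw [hspec]; simp only [Matrix.mul_assoc]
      _ = _ := by rw [hUU, Matrix.one_mul, Matrix.mul_one]
  have hp0 : ∀ x, 0 ≤ p x := (Matrix.posSemidef_self_mul_conjTranspose M).eigenvalues_nonneg
  have hp1 : ∑ x, p x = 1 := by
    apply Complex.ofReal_inj.1
    rw [← hM, sum_sq_eq_trace, hρ.trace_eq_sum_eigenvalues]
    simp only [Complex.coe_algebraMap, Complex.ofReal_sum, hp]
  rw [entropy_eq_shannon hρ]
  obtain ⟨N, hN⟩ := exists_sum_compl_typicalSet_le hp0 hp1 hδ hη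
  refine ⟨N, fun n hn => ?_⟩
  have h1 : tensorPower M n = tensorPower U n * tensorPower (U.conjTranspose * M) n := by
    rw [← tensorPower_mul, ← Matrix.mul_assoc, hUU', Matrix.one_mul]
  rw [h1]
  have h2 : (tensorPower U n).conjTranspose * tensorPower U n = 1 := by
    rw [conjTranspose_tensorPower, ← tensorPower_mul, hUU, tensorPower_one]
  have h3 : tensorPower (U.conjTranspose * M) n * (tensorPower (U.conjTranspose * M) n).conjTranspose
      = Matrix.diagonal fun t => ((∏ i, p (t i) : ℝ) : ℂ) := by
    rw [conjTranspose_tensorPower, ← tensorPower_mul, hC, tensorPower_diagonal]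
    simp only [Complex.ofReal_prod]
  exact ⟨_, isTruncation_of_diagonal h2 h3 (typicalSet p δ n) (hN n hn)
    (fun t ht => prod_le_of_mem_typicalSet ht) (by positivity) (card_typicalSet_le hp0 hp1 δ n)⟩

/-! ### Many copies -/

section Copies

variable {A B R W E : Type} [Fintype A] [Fintype B] [Fintype R] [Fintype W] [Fintype E]

lemma normSq_copies {ψ : A × B × R → ℂ} (hψ : normSq ψ = 1) (n : ℕ) :
    normSq (copies ψ n) = 1 := by
  rw [← sum_prod_eq_one hψ n, normSq,
    ← Equiv.sum_comp ((Equiv.arrowProdEquivProdArrow (Fin n) (fun _ => A) fun _ => B × R).trans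
      ((Equiv.refl _).prodCongr (Equiv.arrowProdEquivProdArrow (Fin n) (fun _ => B) fun _ => R)))]
  refine Finset.sum_congr rfl fun t _ => ?_
  rw [copies, norm_prod, Finset.prod_pow]
  rfl

/-- `N^{⊗n}` for a family of Kraus operators. -/
def krausPower (N : E → Matrix W R ℂ) (n : ℕ) (e : Fin n → E) :
    Matrix (Fin n → W) (Fin n → R) ℂ := fun s t => ∏ i, N (e i) (s i) (t i)

lemma IsIsometric.krausPower [DecidableEq R] {N : E → Matrix W R ℂ} (h : IsIsometric N) (n : ℕ) :
    IsIsometric (krausPower N n) := by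
  unfold IsIsometric
  rw [← tensorPower_one, ← show ∑ e, (N e).conjTranspose * N e = 1 from h]
  ext s t
  simp only [tensorPower, Matrix.sum_apply, Matrix.mul_apply, Finset.prod_univ_sum,
    Fintype.piFinset_univ, Matrix.conjTranspose_apply, StateExchange.krausPower, star_prod,
    Finset.prod_mul_distrib]

lemma dilate_krausPower (N : E → Matrix W R ℂ) (ψ : A × B × R → ℂ) (n : ℕ)
    (x : (Fin n → A) × (Fin n → B) × (Fin n → W) × (Fin n → E)) :
    dilate (krausPower N n) (copies ψ n) x
      = ∏ i, dilate N ψ (x.1 i, x.2.1 i, x.2.2.1 i, x.2.2.2 i) := by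
  simp only [dilate, krausPower, copies, Finset.prod_univ_sum, Fintype.piFinset_univ,
    Finset.prod_mul_distrib]

/-- A vector of `A ⊗ B ⊗ W ⊗ E`, as an operator `B ⊗ E → A ⊗ W`. -/
def cutMatrix (v : A × B × W × E → ℂ) : Matrix (A × W) (B × E) ℂ :=
  fun p q => v (p.1, q.1, p.2, q.2)

/-- A vector of `A ⊗ B ⊗ R`, as an operator `B ⊗ R → A`. -/
def sideMatrix (v : A × B × R → ℂ) : Matrix A (B × R) ℂ := fun a y => v (a, y.1, y.2)

/-- The Kraus index of `Λ` is the environment of the dilation, and the dilated vector purifies the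
channel's output. -/
lemma applySnd_stateAR [DecidableEq A] [DecidableEq R] {V : Type} [Fintype V] (Λ : Kraus R V)
    (ψ : A × B × R → ℂ) :
    Λ.applySnd (stateAR ψ)
      = cutMatrix (dilate Λ.op ψ) * (cutMatrix (dilate Λ.op ψ)).conjTranspose := by
  have h1 : stateAR ψ = ∑ b, Matrix.vecMulVec (fun x => ψ (x.1, b, x.2))
      (star fun x => ψ (x.1, b, x.2)) := by
    ext x y
    simp only [stateAR, Matrix.sum_apply, Matrix.vecMulVec_apply, Pi.star_apply]
  have h2 : ∀ o b, ((1 : Matrix A A ℂ) ⊗ₖ Λ.op o).mulVec (fun x => ψ (x.1, b, x.2))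
      = fun p => dilate Λ.op ψ (p.1, b, p.2, o) := by
    intro o b
    funext p
    simp [Matrix.mulVec, dotProduct, Matrix.kroneckerMap_apply, Fintype.sum_prod_type, dilate,
      Matrix.one_apply]
  ext x y
  rw [Kraus.applySnd, Matrix.sum_apply, Matrix.mul_apply, Fintype.sum_prod_type, Finset.sum_comm]
  refine Finset.sum_congr rfl fun o _ => ?_
  rw [h1, Matrix.mul_sum, Matrix.sum_mul, Matrix.sum_apply]
  refine Finset.sum_congr rfl fun b _ => ?_
  rw [Matrix.mul_vecMulVec, Matrix.vecMulVec_mul, ← Matrix.star_mulVec, h2]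
  rfl

lemma exists_isTruncation_cutMatrix [DecidableEq A] [DecidableEq W] {N : E → Matrix W R ℂ}
    {ψ : A × B × R → ℂ} (hψ : normSq (dilate N ψ) = 1) {S : ℝ}
    (hS : S = entropy (cutMatrix (dilate N ψ) * (cutMatrix (dilate N ψ)).conjTranspose)) {δ η : ℝ}
    (hδ : 0 < δ) (hη : 0 < η) :
    ∃ n₀ : ℕ, ∀ n, n₀ ≤ n → ∃ P,
      IsTruncation P (cutMatrix (dilate (krausPower N n) (copies ψ n))) η
        ((2 : ℝ) ^ (-(n * (S - δ)))) ((2 : ℝ) ^ (n * (S + δ))) := by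
  have hM : ∑ x, ∑ y, ‖cutMatrix (dilate N ψ) x y‖ ^ 2 = 1 := by
    rw [← hψ]
    simp only [normSq, Fintype.sum_prod_type, cutMatrix]
    exact Finset.sum_congr rfl fun a _ => Finset.sum_comm
  obtain ⟨n₀, h⟩ := exists_isTruncation_tensorPower hM hδ hη
  refine ⟨n₀, fun n hn => ?_⟩
  obtain ⟨P, hP⟩ := h n hn
  have h1 : cutMatrix (dilate (krausPower N n) (copies ψ n))
      = (tensorPower (cutMatrix (dilate N ψ)) n).submatrix
        (Equiv.arrowProdEquivProdArrow (Fin n) (fun _ => A) fun _ => W).symm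
        (Equiv.arrowProdEquivProdArrow (Fin n) (fun _ => B) fun _ => E).symm := by
    ext p q
    exact dilate_krausPower N ψ n _
  rw [h1, hS]
  exact ⟨_, hP.submatrix _ _⟩

lemma exists_isTruncation_sideMatrix [DecidableEq A] {ψ : A × B × R → ℂ} (hψ : normSq ψ = 1)
    {S : ℝ} (hS : S = entropy (sideMatrix ψ * (sideMatrix ψ).conjTranspose)) {δ η : ℝ}
    (hδ : 0 < δ) (hη : 0 < η) :
    ∃ n₀ : ℕ, ∀ n, n₀ ≤ n → ∃ P, IsTruncation P (sideMatrix (copies ψ n)) η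
      ((2 : ℝ) ^ (-(n * (S - δ)))) ((2 : ℝ) ^ (n * (S + δ))) := by
  have hM : ∑ x, ∑ y, ‖sideMatrix ψ x y‖ ^ 2 = 1 := by
    rw [← hψ]
    simp only [normSq, Fintype.sum_prod_type, sideMatrix]
  obtain ⟨n₀, h⟩ := exists_isTruncation_tensorPower hM hδ hη
  refine ⟨n₀, fun n hn => ?_⟩
  obtain ⟨P, hP⟩ := h n hn
  rw [hS]
  exact ⟨_, hP.submatrix (Equiv.refl _)
      (Equiv.arrowProdEquivProdArrow (Fin n) (fun _ => B) fun _ => R).symm⟩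

lemma matrixCopies_stateRA (ψ : A × B × R → ℂ) (n : ℕ) :
    matrixCopies (stateRA ψ) n
      = ∑ b, Matrix.vecMulVec (fun x => copies ψ n (x.2, b, x.1))
          (star fun x => copies ψ n (x.2, b, x.1)) := by
  ext x y
  simp only [matrixCopies, stateRA, Matrix.sum_apply, Matrix.vecMulVec_apply, copies,
    Pi.star_apply, star_prod, Finset.prod_univ_sum, Fintype.piFinset_univ, Finset.prod_mul_distrib]

/-- In the purification the squared fidelity with `Φ_ℓ` is the total weight of the leftover states,
summed over a basis of `Bⁿ`. -/
lemma fidelity_runOneWay [DecidableEq A] [DecidableEq R] {ψ : A × B × R → ℂ} {n ℓ : ℕ}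
    (hℓ : 0 < ℓ) (M : Kraus (Fin n → R) (Fin ℓ)) (D : Fin M.num → Kraus (Fin n → A) (Fin ℓ)) :
    fidelity (runOneWay M D (matrixCopies (stateRA ψ) n)) (proj (maxEnt ℓ))
      = Real.sqrt (∑ o, ∑ j, ∑ b,
        ‖distillRest M.op (fun o => (D o).op) (copies ψ n) o j b‖ ^ 2) := by
  refine fidelity_proj (isUnitVector_maxEnt hℓ) _ _ (Finset.sum_nonneg fun _ _ =>
    Finset.sum_nonneg fun _ _ => Finset.sum_nonneg fun _ _ => sq_nonneg _) ?_
  rw [runOneWay, Matrix.sum_mulVec, dotProduct_sum]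
  push_cast
  refine Finset.sum_congr rfl fun o _ => ?_
  rw [Matrix.sum_mulVec, dotProduct_sum]
  refine Finset.sum_congr rfl fun j _ => ?_
  rw [matrixCopies_stateRA, Matrix.mul_sum, Matrix.sum_mul, Matrix.sum_mulVec, dotProduct_sum]
  refine Finset.sum_congr rfl fun b _ => ?_
  rw [dotProduct_kraus_proj]
  push_cast
  congr 3
  simp only [dotProduct, Matrix.mulVec, Fintype.sum_prod_type, Pi.star_apply, star_maxEnt,
    Matrix.kroneckerMap_apply, distillRest, Finset.mul_sum, dilate]
  refine Finset.sum_congr rfl fun w _ => ?_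
  rw [Finset.sum_eq_single w (fun w' _ hw => by simp [maxEnt, Ne.symm hw]) (by simp)]
  rw [Finset.sum_comm]
  refine Finset.sum_congr rfl fun a _ => Finset.sum_congr rfl fun r _ => ?_
  rw [maxEnt, if_pos rfl]
  ring

end Copies

/-! ### The roles of the two parties -/

section Swap

variable {A B A' B' S ι : Type*} [Fintype A] [Fintype B] [Fintype A'] [Fintype B'] [Fintype S]
  [Fintype ι]

lemma amplitude_swapParties (X : Matrix A' A ℂ) (Y : Matrix B' B ℂ) (u : A' × B' × S → ℂ)
    (v : A × B × S → ℂ) : amplitude Y X (swapParties u) (swapParties v) = amplitude X Y u v := by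
  simp only [amplitude, localAct, swapParties, Fintype.sum_prod_type, Matrix.kroneckerMap_apply]
  rw [Finset.sum_comm]
  refine Finset.sum_congr rfl fun a _ => Finset.sum_congr rfl fun b _ =>
    Finset.sum_congr rfl fun s _ => ?_
  rw [Finset.sum_comm]
  simp only [mul_comm (Y _ _)]

lemma swapParties_withEbits (K : ℕ) (v : A × B × S → ℂ) :
    swapParties (withEbits K v) = withEbits K (swapParties v) := by
  funext x
  simp only [swapParties, withEbits, maxEnt, eq_comm]

lemma IsIsometric.kronecker_swap [DecidableEq A] [DecidableEq B] {X : ι → Matrix A' A ℂ}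
    {Y : ι → Matrix B' B ℂ} (h : IsIsometric fun i => X i ⊗ₖ Y i) :
    IsIsometric fun i => Y i ⊗ₖ X i := by
  unfold IsIsometric at h ⊢
  simp only [Matrix.conjTranspose_kronecker, ← Matrix.mul_kronecker_mul] at h ⊢
  ext x y
  have := congrFun (congrFun h x.swap) y.swap
  simp only [Matrix.sum_apply, Matrix.kroneckerMap_apply, Matrix.one_apply, Prod.swap_inj] at this ⊢
  rw [← this]
  exact Finset.sum_congr rfl fun i _ => mul_comm _ _

end Swap

/-! ### Rates -/

lemma neg_sub_le_logb_sub {K L : ℕ} (hK : 0 < K) (hL : 0 < L) {c x : ℝ}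
    (h : (2 : ℝ) ^ (-c) ≤ K / L * 2 ^ x) : -c - x ≤ Real.logb 2 K - Real.logb 2 L := by
  have hK' : (0 : ℝ) < K := by exact_mod_cast hK
  have hL' : (0 : ℝ) < L := by exact_mod_cast hL
  have h1 := Real.logb_le_logb_of_le one_lt_two (by positivity) h
  rw [Real.logb_mul (by positivity) (by positivity), Real.logb_div hK'.ne' hL'.ne',
    Real.logb_rpow two_pos (by norm_num), Real.logb_rpow two_pos (by norm_num)] at h1
  linarith

section Rates

variable {A B R : Type} [Fintype A] [Fintype B] [Fintype R]
  [DecidableEq A] [DecidableEq B] [DecidableEq R]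

lemma isUnitVector_exchangeTarget {ψ : A × B × R → ℂ} (hψ : normSq ψ = 1) (n : ℕ) {L : ℕ}
    (hL : 0 < L) : IsUnitVector (exchangeTarget ψ n L) := by
  have h1 := normSq_withEbits hL (swapParties (copies ψ n))
  rw [normSq_swapParties, normSq_copies hψ] at h1
  exact h1

lemma sq_le_of_le_sqrt {ε x : ℝ} (hε : ε ≤ 1) (hx : 0 ≤ x) (h : 1 - ε ≤ Real.sqrt x) :
    (1 - ε) ^ 2 ≤ x := by
  rw [← Real.sq_sqrt hx]
  exact pow_le_pow_left₀ (by linarith) h 2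

/-- All that later arguments need from a rate: a separable family and its squared fidelity. -/
lemma IsExchangeRate.exists_isIsometric {ψ : A × B × R → ℂ} (hψ : normSq ψ = 1) {q : ℝ}
    (h : IsExchangeRate ψ q) {ε : ℝ} (hε : 0 < ε) (hε1 : ε ≤ 1) :
    ∃ N : ℕ, ∀ n, N ≤ n → ∃ K L : ℕ, 0 < K ∧ 0 < L ∧
      Real.logb 2 K - Real.logb 2 L ≤ n * (q + ε) ∧
      ∃ (m : ℕ) (X : Fin m → Matrix ((Fin n → B) × Fin L) ((Fin n → A) × Fin K) ℂ)
        (Y : Fin m → Matrix ((Fin n → A) × Fin L) ((Fin n → B) × Fin K) ℂ),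
        (IsIsometric fun i => X i ⊗ₖ Y i) ∧
        (1 - ε) ^ 2 ≤ ∑ i, ‖amplitude (X i) (Y i) (withEbits L (swapParties (copies ψ n)))
          (withEbits K (copies ψ n))‖ ^ 2 := by
  obtain ⟨N, hN⟩ := h ε hε
  refine ⟨N, fun n hn => ?_⟩
  obtain ⟨K, L, hK, hL, hq, T, hT, hF⟩ := hN n hn
  refine ⟨K, L, hK, hL, hq, T.length, fun i => T[i].1, fun i => T[i].2, hT.isIsometric, ?_⟩
  rw [fidelity_runLOCC T _ _ (isUnitVector_exchangeTarget hψ n hL)] at hF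
  exact sq_le_of_le_sqrt hε1 (Finset.sum_nonneg fun _ _ => sq_nonneg _) hF

lemma IsOneWayDistillationRate.exists_distillRest {ψ : A × B × R → ℂ} {q : ℝ}
    (h : IsOneWayDistillationRate (stateRA ψ) q) {ε : ℝ} (hε : 0 < ε) (hε1 : ε ≤ 1) :
    ∃ N : ℕ, ∀ n, N ≤ n → ∃ ℓ : ℕ, 0 < ℓ ∧ n * (q - ε) ≤ Real.logb 2 ℓ ∧
      ∃ (M : Kraus (Fin n → R) (Fin ℓ)) (D : Fin M.num → Kraus (Fin n → A) (Fin ℓ)),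
        (1 - ε) ^ 2 ≤ ∑ o, ∑ j, ∑ b,
          ‖distillRest M.op (fun o => (D o).op) (copies ψ n) o j b‖ ^ 2 := by
  obtain ⟨N, hN⟩ := h ε hε
  refine ⟨N, fun n hn => ?_⟩
  obtain ⟨ℓ, hℓ, hq, M, D, hF⟩ := hN n hn
  refine ⟨ℓ, hℓ, hq, M, D, ?_⟩
  rw [fidelity_runOneWay hℓ] at hF
  exact sq_le_of_le_sqrt hε1 (Finset.sum_nonneg fun _ _ => Finset.sum_nonneg fun _ _ =>
    Finset.sum_nonneg fun _ _ => sq_nonneg _) hF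

theorem IsExchangeRate.entropy_sub_le {ψ : A × B × R → ℂ} (hψ : normSq ψ = 1) {q : ℝ}
    (h : IsExchangeRate ψ q) {V : Type} [Fintype V] [DecidableEq V] (Λ : Kraus R V) :
    entropy (Λ.applySnd (stateBR ψ)) - entropy (Λ.applySnd (stateAR ψ)) ≤ q := by
  by_contra hlt
  set SB := entropy (Λ.applySnd (stateBR ψ)) with hSB
  set SA := entropy (Λ.applySnd (stateAR ψ)) with hSA
  set g := SB - SA - q with hg
  have hg0 : 0 < g := by linarith [not_le.1 hlt]
  have hSA' := hSA
  rw [applySnd_stateAR] at hSA'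
  -- `stateBR ψ` is `stateAR` of the swapped vector by definition.
  have hSB' : SB = entropy (Λ.applySnd (stateAR (swapParties ψ))) := hSB
  rw [applySnd_stateAR] at hSB'
  have hψ' : normSq (swapParties ψ) = 1 := (normSq_swapParties ψ).trans hψ
  have hδ : 0 < g / 8 := by positivity
  have hη : (0 : ℝ) < 1 / 100 := by norm_num
  obtain ⟨N₁, h₁⟩ := exists_isTruncation_cutMatrix (N := Λ.op) (ψ := ψ)
    ((normSq_dilate Λ.isIsometric ψ).trans hψ) hSA' hδ hη
  obtain ⟨N₂, h₂⟩ := exists_isTruncation_cutMatrix (N := Λ.op) (ψ := swapParties ψ)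
    ((normSq_dilate Λ.isIsometric _).trans hψ') hSB' hδ hη
  obtain ⟨N₃, h₃⟩ := h.exists_isIsometric hψ (ε := min (g / 8) (1 / 10)) (by positivity)
    ((min_le_right _ _).trans (by norm_num))
  obtain ⟨N₄, h₄⟩ := exists_nat_ge (8 / g)
  set n := max (max N₁ N₂) (max N₃ N₄) with hn
  obtain ⟨P, hP⟩ := h₁ n ((le_max_left _ _).trans (le_max_left _ _))
  obtain ⟨Q, hQ⟩ := h₂ n ((le_max_right _ _).trans (le_max_left _ _))
  obtain ⟨K, L, hK, hL, hq, m, X, Y, hXY, hF⟩ := h₃ n ((le_max_left _ _).trans (le_max_right _ _))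
  have hng : 8 ≤ n * g := by
    rw [← div_le_iff₀ hg0]
    exact h₄.trans (by exact_mod_cast (le_max_right _ _).trans (le_max_right _ _))
  have hbound := sum_sq_exchange_cut_le hK hL hXY (normSq_copies hψ n) (Λ.isIsometric.krausPower n)
    (by norm_num) (by positivity) hP hQ
  have hε1 : min (g / 8) (1 / 10) ≤ 1 / 10 := min_le_right _ _
  have hε2 : min (g / 8) (1 / 10) ≤ g / 8 := min_le_left _ _
  have h5 : (9 / 10 : ℝ) ^ 2 ≤ (1 - min (g / 8) (1 / 10)) ^ 2 :=
    pow_le_pow_left₀ (by norm_num) (by linarith) 2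
  -- From `0.81 ≤ 3x + 15/100` one gets `x ≥ 0.22`, which exceeds `1/8`.
  have h6 : (2 : ℝ) ^ (-3 : ℝ) ≤ K / L * 2 ^ (n * (SA + g / 8) + -(n * (SB - g / 8))) := by
    rw [Real.rpow_add two_pos, show (-3 : ℝ) = ((-3 : ℤ) : ℝ) by norm_num, Real.rpow_intCast]
    norm_num at h5 hbound ⊢
    linarith
  have h7 := neg_sub_le_logb_sub hK hL h6
  have hn0 : (0 : ℝ) ≤ n := Nat.cast_nonneg n
  -- Two truncation errors `g/8` and the rate error `g/8` leave `(5/8) n g ≤ 3`, against `n g ≥ 8`.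
  have h8 := mul_le_mul_of_nonneg_left hε2 hn0
  have h9 : n * g = n * SB - n * SA - n * q := by rw [hg]; ring
  nlinarith

/-- One-shot consequence of distillation from the reference to the first party. -/
lemma logb_sub_ge_of_distill {ψ : A × B × R → ℂ} (hψ : normSq ψ = 1) {n K L ℓ m : ℕ}
    (hK : 0 < K) (hL : 0 < L) (hℓ : 0 < ℓ)
    {X : Fin m → Matrix ((Fin n → B) × Fin L) ((Fin n → A) × Fin K) ℂ}
    {Y : Fin m → Matrix ((Fin n → A) × Fin L) ((Fin n → B) × Fin K) ℂ}
    (hXY : IsIsometric fun i => X i ⊗ₖ Y i)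
    {ε δ SA SB : ℝ} (hε0 : 0 < ε) (hε : ε ≤ 1 / 200)
    (hF : (1 - ε) ^ 2 ≤ ∑ i, ‖amplitude (X i) (Y i) (withEbits L (swapParties (copies ψ n)))
          (withEbits K (copies ψ n))‖ ^ 2)
    (M : Kraus (Fin n → R) (Fin ℓ)) (D : Fin M.num → Kraus (Fin n → A) (Fin ℓ))
    (hD : (1 - ε) ^ 2 ≤ ∑ o, ∑ j, ∑ b,
          ‖distillRest M.op (fun o => (D o).op) (copies ψ n) o j b‖ ^ 2)
    {P : Matrix (Fin n → A) (Fin n → A) ℂ} {Q : Matrix (Fin n → B) (Fin n → B) ℂ}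
    (hP : IsTruncation P (sideMatrix (copies ψ n)) (1 / 1000)
      ((2 : ℝ) ^ (-(n * (SA - δ)))) ((2 : ℝ) ^ (n * (SA + δ))))
    (hQ : IsTruncation Q (sideMatrix (swapParties (copies ψ n))) (1 / 1000)
      ((2 : ℝ) ^ (-(n * (SB - δ)))) ((2 : ℝ) ^ (n * (SB + δ)))) :
    2 * Real.logb 2 ℓ + n * (SB - SA) - 4 * (n * δ) - 4 ≤ Real.logb 2 K - Real.logb 2 L := by
  have hℓ' : (0 : ℝ) < ℓ := by exact_mod_cast hℓ
  have h1 : 1 - 2 * ε ≤ (1 - ε) ^ 2 := by nlinarith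
  have hbound := sum_sq_exchange_distill_le hK hL hℓ hXY (normSq_copies hψ n) M.isIsometric
    (fun o => (D o).isIsometric) (ε := 2 * ε) (h1.trans hD) hP hQ
  have h2 : (ℓ : ℝ)⁻¹ ^ 2 * ((2 : ℝ) ^ (-(n * (SB - δ)))) ^ 2
      * ((2 : ℝ) ^ (n * (SA + δ)) * (2 : ℝ) ^ (n * (SB + δ)))
      = 2 ^ (2 * -Real.logb 2 ℓ + 2 * -(n * (SB - δ)) + (n * (SA + δ) + n * (SB + δ))) := by
    rw [Real.rpow_add two_pos, Real.rpow_add two_pos, Real.rpow_add two_pos, two_mul, two_mul,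
      Real.rpow_add two_pos, Real.rpow_add two_pos, Real.rpow_neg two_pos.le (Real.logb 2 ℓ),
      Real.rpow_logb two_pos (by norm_num) hℓ']
    ring
  rw [h2] at hbound
  -- Here `0.99 ≤ 9x + 36ε + 24/1000` with `36ε ≤ 0.18`, so `x ≥ 0.087`, which exceeds `1/16`.
  have h3 : (2 : ℝ) ^ (-4 : ℝ) ≤ K / L *
      2 ^ (2 * -Real.logb 2 ℓ + 2 * -(n * (SB - δ)) + (n * (SA + δ) + n * (SB + δ))) := by
    rw [show (-4 : ℝ) = ((-4 : ℤ) : ℝ) by norm_num, Real.rpow_intCast,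
      show (2 : ℝ) ^ (-4 : ℤ) = 1 / 16 by norm_num]
    linarith
  have h4 := neg_sub_le_logb_sub hK hL h3
  linarith

theorem IsExchangeRate.add_distillation_le {ψ : A × B × R → ℂ} (hψ : normSq ψ = 1) {q q₁ q₂ : ℝ}
    (h : IsExchangeRate ψ q) (h₁ : IsOneWayDistillationRate (stateRA ψ) q₁)
    (h₂ : IsOneWayDistillationRate (stateRB ψ) q₂) : q₁ + q₂ ≤ q := by
  by_contra hlt
  set g := q₁ + q₂ - q with hg
  have hg0 : 0 < g := by linarith [not_le.1 hlt]
  have h₂' : IsOneWayDistillationRate (stateRA (swapParties ψ)) q₂ := h₂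
  have hψ' : normSq (swapParties ψ) = 1 := (normSq_swapParties ψ).trans hψ
  -- In the average of the two one-shot bounds the errors add up to `7nε + 4`: `4ε` from truncation,
  -- `2ε` from the distillation rates, `ε` from the exchange rate. With `ε ≤ g/14` this gives `n g ≤
  -- 8`, contradicting `n g ≥ 9`.
  obtain ⟨ε, hε0, hε, hεg⟩ : ∃ ε : ℝ, 0 < ε ∧ ε ≤ 1 / 200 ∧ ε ≤ g / 14 :=
    ⟨min (1 / 200) (g / 14), by positivity, min_le_left _ _, min_le_right _ _⟩
  have hη : (0 : ℝ) < 1 / 1000 := by norm_num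
  obtain ⟨N₁, k₁⟩ := exists_isTruncation_sideMatrix hψ rfl hε0 hη
  obtain ⟨N₂, k₂⟩ := exists_isTruncation_sideMatrix hψ' rfl hε0 hη
  obtain ⟨N₃, k₃⟩ := h.exists_isIsometric hψ hε0 (by linarith)
  obtain ⟨N₄, k₄⟩ := h₁.exists_distillRest hε0 (by linarith)
  obtain ⟨N₅, k₅⟩ := h₂'.exists_distillRest hε0 (by linarith)
  obtain ⟨N₆, k₆⟩ := exists_nat_ge (9 / g)
  obtain ⟨n, n₁, n₂, n₃, n₄, n₅, n₆⟩ :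
      ∃ n, N₁ ≤ n ∧ N₂ ≤ n ∧ N₃ ≤ n ∧ N₄ ≤ n ∧ N₅ ≤ n ∧ N₆ ≤ n :=
    ⟨N₁ + N₂ + N₃ + N₄ + N₅ + N₆, by omega, by omega, by omega, by omega, by omega, by omega⟩
  obtain ⟨P, hP⟩ := k₁ n n₁
  obtain ⟨Q, hQ⟩ := k₂ n n₂
  obtain ⟨K, L, hK, hL, hq, m, X, Y, hXY, hF⟩ := k₃ n n₃
  obtain ⟨ℓ₁, hℓ₁, hq₁, M₁, D₁, hD₁⟩ := k₄ n n₄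
  obtain ⟨ℓ₂, hℓ₂, hq₂, M₂, D₂, hD₂⟩ := k₅ n n₅
  have hng : 9 ≤ n * g := by
    rw [← div_le_iff₀ hg0]
    exact k₆.trans (by exact_mod_cast n₆)
  have hA := logb_sub_ge_of_distill hψ hK hL hℓ₁ hXY hε0 hε hF M₁ D₁ hD₁ hP hQ
  have hF' : (1 - ε) ^ 2 ≤ ∑ i, ‖amplitude (Y i) (X i)
      (withEbits L (swapParties (copies (swapParties ψ) n)))
      (withEbits K (copies (swapParties ψ) n))‖ ^ 2 := by
    refine hF.trans (le_of_eq ?_)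
    refine Finset.sum_congr rfl fun i _ => ?_
    rw [← amplitude_swapParties, swapParties_withEbits, swapParties_withEbits]
    rfl
  -- The same protocol with the parties renamed: the entropy difference changes sign and cancels
  -- against the one in `hA`.
  have hB := logb_sub_ge_of_distill hψ' hK hL hℓ₂ hXY.kronecker_swap hε0 hε hF' M₂ D₂ hD₂ hQ hP
  have hn0 : (0 : ℝ) ≤ n := Nat.cast_nonneg n
  have h8 := mul_le_mul_of_nonneg_left hεg hn0
  have h9 : n * g = n * q₁ + n * q₂ - n * q := by rw [hg]; ring
  nlinarith

end Rates

end StateExchange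

end

theorem theorem2 {A B R : Type} [Fintype A] [Fintype B] [Fintype R]
    [DecidableEq A] [DecidableEq B] [DecidableEq R]
    (ψ : A × B × R → ℂ) (hψ : StateExchange.IsUnitVector ψ) :
    StateExchange.oneWayDistillable (StateExchange.stateRA ψ)
        + StateExchange.oneWayDistillable (StateExchange.stateRB ψ)
      ≤ StateExchange.uncommonInformation ψ ∧
    ∀ (V : Type) [Fintype V] [DecidableEq V] (Λ : StateExchange.Kraus R V),
      ((StateExchange.entropy (Λ.applySnd (StateExchange.stateBR ψ))
          - StateExchange.entropy (Λ.applySnd (StateExchange.stateAR ψ)) : ℝ) : EReal)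
        ≤ StateExchange.uncommonInformation ψ := by
  refine ⟨le_iInf₂ fun q hq => EReal.add_le_of_forall_lt fun x hx y hy => ?_,
    fun V _ _ Λ => le_iInf₂ fun q hq => EReal.coe_le_coe_iff.2 (hq.entropy_sub_le hψ Λ)⟩
  simp only [StateExchange.oneWayDistillable, lt_iSup_iff] at hx hy
  obtain ⟨q₁, hq₁, hx⟩ := hx
  obtain ⟨q₂, hq₂, hy⟩ := hy
  refine (add_le_add hx.le hy.le).trans ?_
  rw [← EReal.coe_add]
  exact EReal.coe_le_coe_iff.2 (hq.add_distillation_le hψ hq₁ hq₂)
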